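/- Let $r\ge 1$ be an integer. For $t\in[-1,1]$ let $$E_r(t)=\mathbb{E}\left[\frac{Zx}{\|Zx\|}\cdot\frac{Zy}{\|Zy\|}\right],$$ where $x,y$ are real unit vectors (in some $\mathbb{R}^n$) with $x\cdot y=t$ and $Z\in\mathbb{R}^{r\times n}$ is a random matrix with independent standard normal entries; the value depends only on $r$ and $t$. Let $E_r^{-1}$ denote the inverse of the bijection $E_r\colon[-1,1]\to[-1,1]$ and let $b_n$ be the $n$-th Taylor coefficient of $E_r^{-1}$ at $0$. Let $G=(V,E)$ be a finite simple graph with at least one edge, and let $\vartheta(\overline G)$ be the Lovász theta number of its complement, i.e. the minimum of all real $\lambda$ for which there is a positive semidefinite matrix $Z\in\mathbb{R}^{V\times V}$ with $Z(u,u)=\lambda-1$ for all $u\in V$ and $Z(u,v)=-1$ for all $\{u,v\}\in E$. Then there is exactly one real number $\beta=\beta(r,G)$ with $$\sum_{k=0}^\infty |b_{2k+1}|\,\beta^{2k+1}=\frac{1}{\vartheta(\overline G)-1}$$ (the series being convergent), and $E_r^{-1}(t)=\sum_{k=0}^\infty b_{2k+1}t^{2k+1}$ for all real $t$ with $|t|\le\beta$.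 Moreover, for every $f\colon V\to S^{|V|-1}$ there is $g\colon V\to S^{|V|-1}$ such that $$E_r\big(g(u)\cdot g(v)\big)=\beta(r,G)\,f(u)\cdot f(v)\qquad\text{whenever } u,v \text{ are adjacent in } G.$$ Here $S^{|V|-1}$ is the unit sphere of $\mathbb{R}^{|V|}$. -/

import Mathlib

open MeasureTheory ProbabilityTheory

namespace RankGrothendieck

/-- `S^{n-1}`, the unit sphere of the Euclidean space `ℝⁿ`. -/
abbrev unitSphere (n : ℕ) : Set (EuclideanSpace ℝ (Fin n)) := Metric.sphere 0 1

/-- The law of a random real matrix with rows indexed by `Fin r` and columns indexed by `ι`, all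
of whose entries are independent standard normal variables. -/
noncomputable def gaussianMatrix (r : ℕ) (ι : Type*) [Fintype ι] : Measure (Fin r → ι → ℝ) :=
  Measure.pi fun _ => Measure.pi fun _ => gaussianReal 0 1

/-- The vector `Z x / ‖Z x‖` of `ℝʳ` (with value `0` if `Z x = 0`, which for `r ≥ 1` and `x ≠ 0`
has probability `0` under the Gaussian law). -/
noncomputable def normalizedImage {r : ℕ} {ι : Type*} [Fintype ι] (Z : Fin r → ι → ℝ)
    (x : EuclideanSpace ℝ ι) : EuclideanSpace ℝ (Fin r) :=
  let y : EuclideanSpace ℝ (Fin r) := WithLp.toLp 2 ((Matrix.of Z).mulVec x.ofLp)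
  ‖y‖⁻¹ • y

/-- `𝔼[(Z x / ‖Z x‖) · (Z y / ‖Z y‖)]` for a standard Gaussian `r × ι` matrix `Z`. -/
noncomputable def gaussianCorrelation (r : ℕ) {ι : Type*} [Fintype ι]
    (x y : EuclideanSpace ℝ ι) : ℝ :=
  ∫ Z, inner ℝ (normalizedImage Z x) (normalizedImage Z y) ∂(gaussianMatrix r ι)

/-- The function `E_r` on `[-1, 1]`: `E r t` is the above expectation for two unit vectors with
inner product `t`. It is written with the unit vectors `(1, 0)` and `(t, √(1 - t²))` of the plane;
by `gaussianCorrelation_eq_E` any two unit vectors with inner product `t`, in any dimension, give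
the same value. Values outside `[-1, 1]` are never used. -/
noncomputable def E (r : ℕ) (t : ℝ) : ℝ :=
  gaussianCorrelation r (!₂[1, 0] : EuclideanSpace ℝ (Fin 2)) !₂[t, √(1 - t ^ 2)]

section WellDefined

/-- The pair `(z · a, z · b)`. -/
noncomputable def dotPair {ι : Type*} [Fintype ι] (a b : EuclideanSpace ℝ ι) (z : ι → ℝ) :
    EuclideanSpace ℝ (Fin 2) :=
  !₂[z ⬝ᵥ a.ofLp, z ⬝ᵥ b.ofLp]

lemma measurable_dotPair {ι : Type*} [Fintype ι] (a b : EuclideanSpace ℝ ι) :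
    Measurable (dotPair a b) := by
  apply Continuous.measurable
  refine (PiLp.continuous_toLp 2 _).comp (continuous_pi fun i => ?_)
  fin_cases i <;> simp only [dotProduct] <;> fun_prop

lemma charFun_dotPair {ι : Type*} [Fintype ι] (a b : EuclideanSpace ℝ ι)
    (s : EuclideanSpace ℝ (Fin 2)) :
    charFun ((Measure.pi fun _ : ι => gaussianReal 0 1).map (dotPair a b)) s =
      Complex.exp (- ((‖s 0 • a + s 1 • b‖ : ℝ) : ℂ) ^ 2 / 2) := by
  rw [← charFun_stdGaussian, ← map_pi_eq_stdGaussian, charFun_apply, charFun_apply,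
    integral_map (measurable_dotPair a b).aemeasurable (by fun_prop),
    integral_map (by fun_prop) (by fun_prop)]
  congr 1
  ext z
  have : inner ℝ (dotPair a b z) s = inner ℝ (WithLp.toLp 2 z) (s 0 • a + s 1 • b) := by
    rw [inner_add_right, inner_smul_right, inner_smul_right]
    simp [dotPair, PiLp.inner_apply, Fin.sum_univ_two, dotProduct, mul_comm]
  rw [this]

/-- The joint law of `(z · u, z · v)`, with `z` a standard Gaussian vector, depends only on the
inner products of `u` and `v`. -/
lemma map_dotPair_congr {ι κ : Type*} [Fintype ι] [Fintype κ]
    (u v : EuclideanSpace ℝ ι) (u' v' : EuclideanSpace ℝ κ)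
    (hu : ‖u‖ = 1) (hv : ‖v‖ = 1) (hu' : ‖u'‖ = 1) (hv' : ‖v'‖ = 1)
    (h : inner ℝ u v = inner ℝ u' v') :
    (Measure.pi fun _ : ι => gaussianReal 0 1).map (dotPair u v) =
      (Measure.pi fun _ : κ => gaussianReal 0 1).map (dotPair u' v') := by
  apply Measure.ext_of_charFun
  ext s
  rw [charFun_dotPair, charFun_dotPair]
  have hn : ‖s 0 • u + s 1 • v‖ ^ 2 = ‖s 0 • u' + s 1 • v'‖ ^ 2 := by
    rw [norm_add_sq_real, norm_add_sq_real]
    simp [norm_smul, inner_smul_left, inner_smul_right, hu, hv, hu', hv', h]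
  have : (((‖s 0 • u + s 1 • v‖ : ℝ) : ℂ)) ^ 2 = ((‖s 0 • u' + s 1 • v'‖ : ℝ) : ℂ) ^ 2 := by
    exact_mod_cast hn
  rw [this]

/-- The column of the `j`-th coordinates of `r` points of the plane. -/
noncomputable def column {r : ℕ} (p : Fin r → EuclideanSpace ℝ (Fin 2)) (j : Fin 2) :
    EuclideanSpace ℝ (Fin r) :=
  WithLp.toLp 2 fun i => p i j

lemma measurable_column {r : ℕ} (j : Fin 2) :
    Measurable fun p : Fin r → EuclideanSpace ℝ (Fin 2) => column p j := by
  apply Continuous.measurable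
  unfold column
  fun_prop

lemma gaussianCorrelation_eq_integral (r : ℕ) {ι : Type*} [Fintype ι]
    (a b : EuclideanSpace ℝ ι) :
    gaussianCorrelation r a b =
      ∫ p, inner ℝ (‖column p 0‖⁻¹ • column p 0) (‖column p 1‖⁻¹ • column p 1)
        ∂(Measure.pi fun _ : Fin r =>
          (Measure.pi fun _ : ι => gaussianReal 0 1).map (dotPair a b)) := by
  have hm := measurable_dotPair a b
  have : IsProbabilityMeasure ((Measure.pi fun _ : ι => gaussianReal 0 1).map (dotPair a b)) :=
    Measure.isProbabilityMeasure_map hm.aemeasurable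
  have hF : Measurable fun p : Fin r → EuclideanSpace ℝ (Fin 2) =>
      (inner ℝ (‖column p 0‖⁻¹ • column p 0) (‖column p 1‖⁻¹ • column p 1) : ℝ) :=
    ((measurable_column 0).norm.inv.smul (measurable_column 0)).inner
      ((measurable_column 1).norm.inv.smul (measurable_column 1))
  have hr : Measurable fun (x : Fin r → ι → ℝ) i => dotPair a b (x i) :=
    measurable_pi_lambda _ fun i => hm.comp (measurable_pi_apply i)
  rw [← Measure.pi_map_pi (fun _ => hm.aemeasurable),
    integral_map hr.aemeasurable hF.aestronglyMeasurable]
  rfl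

lemma gaussianCorrelation_congr (r : ℕ) {ι κ : Type*} [Fintype ι] [Fintype κ]
    (u v : EuclideanSpace ℝ ι) (u' v' : EuclideanSpace ℝ κ)
    (hu : ‖u‖ = 1) (hv : ‖v‖ = 1) (hu' : ‖u'‖ = 1) (hv' : ‖v'‖ = 1)
    (h : inner ℝ u v = inner ℝ u' v') :
    gaussianCorrelation r u v = gaussianCorrelation r u' v' := by
  rw [gaussianCorrelation_eq_integral, gaussianCorrelation_eq_integral,
    map_dotPair_congr u v u' v' hu hv hu' hv' h]

/-- `E_r` is well defined: the expectation depends only on the inner product of the two unit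
vectors. -/
theorem gaussianCorrelation_eq_E (r : ℕ) {ι : Type*} [Fintype ι] (x y : EuclideanSpace ℝ ι)
    (hx : ‖x‖ = 1) (hy : ‖y‖ = 1) : gaussianCorrelation r x y = E r (inner ℝ x y) := by
  have h1 : inner ℝ x y ^ 2 ≤ 1 := by
    have := abs_real_inner_le_norm x y
    rw [hx, hy, one_mul] at this
    exact (sq_le_one_iff_abs_le_one _).2 this
  refine gaussianCorrelation_congr r x y _ _ hx hy ?_ ?_ ?_
  · simp [EuclideanSpace.norm_eq, Fin.sum_univ_two]
  · simp [EuclideanSpace.norm_eq, Fin.sum_univ_two, Real.sq_sqrt (sub_nonneg.2 h1)]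
  · simp [PiLp.inner_apply, Fin.sum_univ_two]

end WellDefined

/-- The inverse of the bijection `E_r : [-1, 1] → [-1, 1]`. -/
noncomputable def EInv (r : ℕ) : ℝ → ℝ := Function.invFunOn (E r) (Set.Icc (-1) 1)

/-- The `n`-th Taylor coefficient `b_n` of `E_r⁻¹` at `0`. -/
noncomputable def taylorCoeff (r n : ℕ) : ℝ := iteratedDeriv n (EInv r) 0 / n.factorial

/-- `λ` is the value of a feasible solution of the semidefinite program that defines the theta
number of the complement of `G`. -/
def ThetaFeasible {V : Type*} (G : SimpleGraph V) (lam : ℝ) : Prop :=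
  ∃ Z : Matrix V V ℝ, Z.PosSemidef ∧ (∀ u, Z u u = lam - 1) ∧ ∀ u v, G.Adj u v → Z u v = -1

/-- The Lovász theta number `ϑ(Ḡ)` of the complement of `G`, as the optimal value of that
program. -/
noncomputable def thetaCompl {V : Type*} (G : SimpleGraph V) : ℝ :=
  sInf {lam : ℝ | ThetaFeasible G lam}

/-- `β` solves the equation `∑ₖ |b_{2k+1}| β^{2k+1} = 1 / (ϑ(Ḡ) - 1)`; convergence of the series is
part of the claim. -/
def SolvesBetaEquation (r : ℕ) {V : Type*} (G : SimpleGraph V) (β : ℝ) : Prop :=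
  HasSum (fun k : ℕ => |taylorCoeff r (2 * k + 1)| * β ^ (2 * k + 1)) (1 / (thetaCompl G - 1))

end RankGrothendieck

namespace RankGrothendieck

/-! Everything rests on the formula E_r(t) = K 𝔼[(U·V) arcsin(t cos∠(U,V))] with K > 0 and U, V
independent standard Gaussian vectors of ℝʳ (`exists_E_eq_integral_arcsin`). It follows by writing
X/‖X‖ as a multiple of 𝔼[sign(U·X) U] and applying Grothendieck's identity to the resulting signs.
Since U·V and the cosine have the same sign, E_r is strictly increasing and extends to a holomorphic
F on the unit disc with Re F' > 0 (`exists_holomorphic_extension`).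

Such an F is injective. Let R be the radius of the largest disc about 0 inside its image. The
inverse h is holomorphic there, and |h| comes arbitrarily close to 1, because the circle of radius R
contains a point outside the image (`exists_holomorphic_inverse`). The coefficients of h are the
b_n, so G(x) = ∑ |b_{2k+1}| x^{2k+1} dominates |h| on |z| = x and takes every value in (0,1], the
value 1 possibly only at x = R (`exists_hasSum_abs_taylorCoeff`). As ϑ ≥ 2, this yields β; strict
monotonicity gives uniqueness. The bound G(β) ≤ 1 also keeps the series inside the unit disc, so the
identity theorem, and continuity at ±β, show that it inverts E_r on [-β, β] (`E_tsum_taylorCoeff`).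

The vectors g come from Krivine's argument with the theta matrix handling signs
(`exists_unitSphere_inner_eq_series`). An optimal Z, and J + (ϑ-2)I with J the all-ones matrix, both
have diagonal ϑ-1, with entries -1 and +1 respectively on edges. Multiplying the k-th term
|b_{2k+1}| (β f(u)·f(v))^{2k+1} entrywise by the one with the sign of b_{2k+1} keeps it positive
semidefinite and restores that sign on edges. The equation for β makes the diagonal of the sum equal
to 1. -/

/-! ### The complex arcsine on the unit disc. -/

/-- The principal branch of the arcsine on the complex unit disc. -/
noncomputable def cArcsin (w : ℂ) : ℂ :=
  -Complex.I * Complex.log (Complex.I * w + (1 - w ^ 2) ^ (1 / 2 : ℂ))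

lemma one_sub_sq_re_pos {w : ℂ} (hw : ‖w‖ < 1) : 0 < (1 - w ^ 2).re := by
  have h1 : (w ^ 2).re ≤ ‖w ^ 2‖ := Complex.re_le_norm _
  have h2 : ‖w ^ 2‖ < 1 := by
    rw [norm_pow]
    exact pow_lt_one₀ (norm_nonneg _) hw two_ne_zero
  simp only [Complex.sub_re, Complex.one_re]
  linarith

lemma sq_cpow_half (z : ℂ) : (z ^ (1 / 2 : ℂ)) ^ 2 = z := by
  rw [← Complex.cpow_nat_mul]
  norm_num

/-- The principal square root halves the argument. -/
lemma cpow_half_re_pos {z : ℂ} (hz : 0 < z.re) : 0 < (z ^ (1 / 2 : ℂ)).re := by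
  have hz0 : z ≠ 0 := by
    rintro rfl
    simp at hz
  have harg := Complex.abs_arg_lt_pi_div_two_iff.2 (Or.inl hz)
  rw [abs_lt] at harg
  rw [Complex.cpow_def_of_ne_zero hz0, Complex.exp_re]
  refine mul_pos (Real.exp_pos _) (Real.cos_pos_of_mem_Ioo ?_)
  have : (Complex.log z * (1 / 2)).im = z.arg / 2 := by
    simp [Complex.mul_im, Complex.log_im]
    ring
  rw [this]
  constructor <;> linarith [Real.pi_pos]

lemma inv_cpow_half_re_pos {w : ℂ} (hw : ‖w‖ < 1) :
    0 < (((1 - w ^ 2) ^ (1 / 2 : ℂ))⁻¹).re := by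
  have h := cpow_half_re_pos (one_sub_sq_re_pos hw)
  rw [Complex.inv_re]
  refine div_pos h (Complex.normSq_pos.2 ?_)
  intro h0
  rw [h0, Complex.zero_re] at h
  exact lt_irrefl _ h

lemma norm_inv_cpow_half_le {w : ℂ} {ρ : ℝ} (hw : ‖w‖ ≤ ρ) (hρ : ρ < 1) :
    ‖((1 - w ^ 2) ^ (1 / 2 : ℂ))⁻¹‖ ≤ (1 - ρ ^ 2)⁻¹ := by
  have h0 : 0 ≤ ρ := (norm_nonneg _).trans hw
  have hρ2 : 0 < 1 - ρ ^ 2 := by nlinarith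
  set q := (1 - w ^ 2) ^ (1 / 2 : ℂ) with hq
  have hq2 : 1 - ρ ^ 2 ≤ ‖q‖ ^ 2 := by
    rw [← norm_pow, hq, sq_cpow_half]
    have : ‖(1 : ℂ)‖ - ‖w ^ 2‖ ≤ ‖1 - w ^ 2‖ := norm_sub_norm_le _ _
    rw [norm_one, norm_pow] at this
    have : ‖w‖ ^ 2 ≤ ρ ^ 2 := by gcongr
    linarith
  rw [norm_inv]
  apply inv_anti₀ hρ2
  -- As 1 - ρ² ≤ 1, a number whose square is at least 1 - ρ² is itself at least 1 - ρ²; this crude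
  -- bound avoids a square root.
  nlinarith [norm_nonneg q, sq_nonneg ρ]

/-- With q the root, (iw + q)(q - iw) = 1. So iw + q and its inverse have real parts of equal sign,
and these add up to 2 Re q > 0. This keeps the logarithm in `cArcsin` off its cut. -/
lemma arcsin_log_arg_re_pos {w : ℂ} (hw : ‖w‖ < 1) :
    0 < (Complex.I * w + (1 - w ^ 2) ^ (1 / 2 : ℂ)).re := by
  set q := (1 - w ^ 2) ^ (1 / 2 : ℂ) with hq
  have hre : 0 < q.re := cpow_half_re_pos (one_sub_sq_re_pos hw)
  have hq2 : q ^ 2 = 1 - w ^ 2 := sq_cpow_half _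
  have hprod : (Complex.I * w + q) * (q - Complex.I * w) = 1 := by
    linear_combination hq2 - w ^ 2 * Complex.I_sq
  have hinv : q - Complex.I * w = (Complex.I * w + q)⁻¹ := eq_inv_of_mul_eq_one_right hprod
  have hne : Complex.I * w + q ≠ 0 := left_ne_zero_of_mul_eq_one hprod
  have hsum : (Complex.I * w + q).re + ((Complex.I * w + q)⁻¹).re = 2 * q.re := by
    rw [← hinv]
    simp
    ring
  by_contra hneg
  push Not at hneg
  have : ((Complex.I * w + q)⁻¹).re ≤ 0 := by
    rw [Complex.inv_re]
    exact div_nonpos_of_nonpos_of_nonneg hneg (Complex.normSq_nonneg _)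
  linarith

lemma hasDerivAt_cArcsin {w : ℂ} (hw : ‖w‖ < 1) :
    HasDerivAt cArcsin ((1 - w ^ 2) ^ (1 / 2 : ℂ))⁻¹ w := by
  set q := (1 - w ^ 2) ^ (1 / 2 : ℂ) with hq
  have hre : 0 < q.re := cpow_half_re_pos (one_sub_sq_re_pos hw)
  have hq2 : q ^ 2 = 1 - w ^ 2 := sq_cpow_half _
  have hq0 : q ≠ 0 := by
    intro h
    simp [h] at hre
  have hpos := arcsin_log_arg_re_pos hw
  have hp0 : Complex.I * w + q ≠ 0 := by
    intro h
    rw [← hq, h] at hpos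
    simp at hpos
  have hw2 : (1 - w ^ 2) ≠ 0 := by
    intro h
    have := one_sub_sq_re_pos hw
    simp [h] at this
  have h1 : HasDerivAt (fun w : ℂ => 1 - w ^ 2) (-(2 * w)) w := by
    simpa using ((hasDerivAt_id w).pow 2).const_sub 1
  have h2 : HasDerivAt (fun w : ℂ => (1 - w ^ 2) ^ (1 / 2 : ℂ)) (-w / q) w := by
    have := h1.cpow_const (c := (1 / 2 : ℂ)) (Or.inl (one_sub_sq_re_pos hw))
    convert this using 1
    rw [Complex.cpow_sub _ _ hw2, ← hq, Complex.cpow_one, ← hq2]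
    field_simp
  have h3 : HasDerivAt (fun w : ℂ => Complex.I * w + (1 - w ^ 2) ^ (1 / 2 : ℂ))
      (Complex.I + -w / q) w :=
    (((hasDerivAt_id w).const_mul Complex.I).add h2).congr_deriv (by rw [mul_one])
  have h4 := (h3.clog (Or.inl hpos)).const_mul (-Complex.I)
  refine h4.congr_deriv ?_
  rw [← hq]
  field_simp
  linear_combination (-q) * Complex.I_sq

lemma cArcsin_zero : cArcsin 0 = 0 := by simp [cArcsin]

lemma cArcsin_ofReal {t : ℝ} (ht : |t| < 1) : cArcsin t = Real.arcsin t := by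
  rw [abs_lt] at ht
  set θ := Real.arcsin t with hθ
  have h1 : -(Real.pi / 2) < θ := Real.neg_pi_div_two_lt_arcsin.2 ht.1
  have h2 : θ < Real.pi / 2 := Real.arcsin_lt_pi_div_two.2 ht.2
  have hsin : t = Real.sin θ := (Real.sin_arcsin ht.1.le ht.2.le).symm
  have hcos : 0 ≤ Real.cos θ := Real.cos_arcsin_nonneg t
  have hsq : (1 - (t : ℂ) ^ 2) ^ (1 / 2 : ℂ) = Real.cos θ := by
    have : (1 - (t : ℂ) ^ 2) = ((1 - t ^ 2 : ℝ) : ℂ) := by push_cast; ring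
    rw [this]
    have h0 : 1 - t ^ 2 = Real.cos θ ^ 2 := by rw [hsin, Real.cos_sq']
    rw [h0, show (1 / 2 : ℂ) = ((1 / 2 : ℝ) : ℂ) by push_cast; rfl,
      ← Complex.ofReal_cpow (sq_nonneg _), ← Real.sqrt_eq_rpow, Real.sqrt_sq hcos]
  rw [cArcsin, hsq, hsin]
  have : Complex.I * (Real.sin θ : ℂ) + Real.cos θ = Complex.exp (θ * Complex.I) := by
    rw [Complex.exp_mul_I]
    push_cast
    ring
  rw [this, Complex.log_exp]
  · linear_combination -(θ : ℂ) * Complex.I_sq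
  · simp; linarith [Real.pi_pos]
  · simp; linarith [Real.pi_pos]

/-- Mean value inequality from 0. The bound makes the integrand of the extension of E_r integrable.
-/
lemma norm_cArcsin_le {w : ℂ} {ρ : ℝ} (hw : ‖w‖ ≤ ρ) (hρ : ρ < 1) :
    ‖cArcsin w‖ ≤ (1 - ρ ^ 2)⁻¹ := by
  have h0 : 0 ≤ ρ := (norm_nonneg _).trans hw
  have hρ2 : 0 < 1 - ρ ^ 2 := by nlinarith
  have := (convex_closedBall (0 : ℂ) ρ).norm_image_sub_le_of_norm_hasDerivWithin_le
    (f := cArcsin) (f' := fun w => ((1 - w ^ 2) ^ (1 / 2 : ℂ))⁻¹) (C := (1 - ρ ^ 2)⁻¹)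
    (fun x hx => (hasDerivAt_cArcsin (by
      rw [mem_closedBall_zero_iff] at hx; linarith)).hasDerivWithinAt)
    (fun x hx => norm_inv_cpow_half_le (by simpa using hx) hρ)
    (Metric.mem_closedBall_self h0) (y := w) (by simpa using hw)
  rw [cArcsin_zero, sub_zero, sub_zero] at this
  refine this.trans (mul_le_of_le_one_right (inv_nonneg.2 hρ2.le) (by linarith))

lemma measurable_cArcsin : Measurable cArcsin := by
  unfold cArcsin
  fun_prop

/-! ### Sign correlations of planar Gaussian vectors. -/

lemma measurable_real_sign : Measurable Real.sign := by
  unfold Real.sign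
  exact Measurable.ite measurableSet_Iio measurable_const
    (Measurable.ite measurableSet_Ioi measurable_const measurable_const)

lemma abs_real_sign_le_one (x : ℝ) : |Real.sign x| ≤ 1 := by
  rcases Real.sign_apply_eq x with h | h | h <;> simp [h]

lemma real_sign_mul_of_pos {c : ℝ} (hc : 0 < c) (x : ℝ) : Real.sign (c * x) = Real.sign x := by
  rcases lt_trichotomy x 0 with h | h | h
  · rw [Real.sign_of_neg h, Real.sign_of_neg (mul_neg_of_pos_of_neg hc h)]
  · simp [h]
  · rw [Real.sign_of_pos h, Real.sign_of_pos (mul_pos hc h)]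

lemma real_sign_mul_self (x : ℝ) : Real.sign x * x = |x| := by
  rcases lt_trichotomy x 0 with h | h | h
  · rw [Real.sign_of_neg h, abs_of_neg h]; ring
  · simp [h]
  · rw [Real.sign_of_pos h, abs_of_pos h]; ring

/-- The angular part of the sign correlation of two planar directions at angle `θ`. -/
lemma integral_sign_cos_mul_sign_cos {θ : ℝ} (h0 : 0 ≤ θ) (hπ : θ ≤ Real.pi) :
    ∫ φ in -Real.pi..Real.pi, Real.sign (Real.cos φ) * Real.sign (Real.cos (φ - θ)) =
      4 * (Real.pi / 2 - θ) := by
  have hp := Real.pi_pos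
  set F : ℝ → ℝ := fun φ => Real.sign (Real.cos φ) * Real.sign (Real.cos (φ - θ)) with hF
  have hper : Function.Periodic F (2 * Real.pi) := by
    intro φ
    simp only [hF]
    rw [Real.cos_add_two_pi, show φ + 2 * Real.pi - θ = φ - θ + 2 * Real.pi by ring,
      Real.cos_add_two_pi]
  have hmeas : Measurable F :=
    (measurable_real_sign.comp Real.measurable_cos).mul
      (measurable_real_sign.comp (Real.measurable_cos.comp (measurable_id.sub_const θ)))
  have hint : ∀ a b, IntervalIntegrable F volume a b := by
    intro a b
    refine (intervalIntegrable_const (c := (1 : ℝ))).mono_fun hmeas.aestronglyMeasurable ?_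
    refine Filter.Eventually.of_forall fun φ => ?_
    simp only [hF, Real.norm_eq_abs, abs_mul, abs_one]
    exact mul_le_one₀ (abs_real_sign_le_one _) (abs_nonneg _) (abs_real_sign_le_one _)
  have key : ∀ {a b c : ℝ}, a ≤ b → (∀ x ∈ Set.Ioo a b, F x = c) →
      ∫ x in a..b, F x = (b - a) * c := by
    intro a b c hab h
    rw [intervalIntegral.integral_congr_Ioo_of_le hab (g := fun _ => c) h]
    simp
  have hposc : ∀ {y : ℝ}, -(Real.pi / 2) < y → y < Real.pi / 2 →
      Real.sign (Real.cos y) = 1 := fun h1 h2 =>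
    Real.sign_of_pos (Real.cos_pos_of_mem_Ioo ⟨h1, h2⟩)
  have hnegc : ∀ {y : ℝ}, Real.pi / 2 < y → y < Real.pi + Real.pi / 2 →
      Real.sign (Real.cos y) = -1 := fun h1 h2 =>
    Real.sign_of_neg (Real.cos_neg_of_pi_div_two_lt_of_lt h1 h2)
  have hnegc' : ∀ {y : ℝ}, -(Real.pi + Real.pi / 2) < y → y < -(Real.pi / 2) →
      Real.sign (Real.cos y) = -1 := by
    intro y h1 h2
    rw [← Real.cos_neg]
    exact hnegc (by linarith) (by linarith)
  -- Over this period the breakpoints are in order: -π/2 ≤ θ - π/2 ≤ π/2 ≤ θ + π/2 ≤ 3π/2, and the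
  -- integrand is constant between them.
  have hshift : ∫ φ in -Real.pi..Real.pi, F φ =
      ∫ φ in -(Real.pi / 2)..(Real.pi + Real.pi / 2), F φ := by
    have := hper.intervalIntegral_add_eq (-Real.pi) (-(Real.pi / 2))
    convert this using 2 <;> ring
  have i1 : ∫ x in -(Real.pi / 2)..(θ - Real.pi / 2), F x = θ * (-1) := by
    rw [key (c := -1) (by linarith)]
    · ring
    · rintro x ⟨hx1, hx2⟩
      simp only [hF]
      rw [hposc hx1 (by linarith), hnegc' (by linarith) (by linarith)]
      norm_num
  have i2 : ∫ x in (θ - Real.pi / 2)..(Real.pi / 2), F x = (Real.pi - θ) * 1 := by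
    rw [key (c := 1) (by linarith)]
    · ring
    · rintro x ⟨hx1, hx2⟩
      simp only [hF]
      rw [hposc (by linarith) hx2, hposc (by linarith) (by linarith)]
      norm_num
  have i3 : ∫ x in (Real.pi / 2)..(θ + Real.pi / 2), F x = θ * (-1) := by
    rw [key (c := -1) (by linarith)]
    · ring
    · rintro x ⟨hx1, hx2⟩
      simp only [hF]
      rw [hnegc hx1 (by linarith), hposc (by linarith) (by linarith)]
      norm_num
  have i4 : ∫ x in (θ + Real.pi / 2)..(Real.pi + Real.pi / 2), F x = (Real.pi - θ) * 1 := by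
    rw [key (c := 1) (by linarith)]
    · ring
    · rintro x ⟨hx1, hx2⟩
      simp only [hF]
      rw [hnegc (by linarith) (by linarith), hnegc (by linarith) (by linarith)]
      norm_num
  rw [hshift, ← intervalIntegral.integral_add_adjacent_intervals (hint _ (θ + Real.pi / 2))
    (hint _ _), ← intervalIntegral.integral_add_adjacent_intervals (hint _ (Real.pi / 2))
    (hint _ _), ← intervalIntegral.integral_add_adjacent_intervals (hint _ (θ - Real.pi / 2))
    (hint _ _), i1, i2, i3, i4]
  ring

lemma integral_pi_gaussianReal_two (F : (Fin 2 → ℝ) → ℝ) :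
    ∫ z, F z ∂(Measure.pi fun _ : Fin 2 => gaussianReal 0 1) =
      ∫ p : ℝ × ℝ, F ![p.1, p.2] ∂((gaussianReal 0 1).prod (gaussianReal 0 1)) := by
  have h := (measurePreserving_finTwoArrow (gaussianReal 0 1)).symm
  rw [← h.integral_comp (MeasurableEquiv.measurableEmbedding _)]
  rfl

lemma integrable_id_gaussianReal : Integrable (fun x : ℝ => x) (gaussianReal 0 1) :=
  (memLp_id_gaussianReal 1).integrable (by simp)

lemma integral_abs_gaussianReal_pos : 0 < ∫ x, |x| ∂(gaussianReal 0 1) := by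
  refine (integral_pos_iff_support_of_nonneg (fun x => abs_nonneg x)
    integrable_id_gaussianReal.abs).2 ?_
  have : (gaussianReal 0 1) {0}ᶜ = 1 := by
    have := nullSingletonClass_gaussianReal (μ := 0) (v := 1) one_ne_zero
    rw [prob_compl_eq_one_iff (measurableSet_singleton _)]
    simp
  have hs : Function.support (fun x : ℝ => |x|) = {0}ᶜ := by
    ext x
    simp
  rw [hs, this]
  exact one_pos

/-- The β term vanishes, since z 1 is independent of z 0 and has mean zero. -/
lemma integral_sign_mul_gaussian_two (α β : ℝ) :
    ∫ z : Fin 2 → ℝ, Real.sign (z 0) * (α * z 0 + β * z 1)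
      ∂(Measure.pi fun _ : Fin 2 => gaussianReal 0 1) =
      α * ∫ x, |x| ∂(gaussianReal 0 1) := by
  rw [integral_pi_gaussianReal_two]
  have hs : Integrable Real.sign (gaussianReal 0 1) :=
    (integrable_const (1 : ℝ)).mono measurable_real_sign.aestronglyMeasurable
      (Filter.Eventually.of_forall fun x => by simpa using abs_real_sign_le_one x)
  have e : (fun p : ℝ × ℝ => Real.sign ((![p.1, p.2] : Fin 2 → ℝ) 0) *
      (α * (![p.1, p.2] : Fin 2 → ℝ) 0 + β * (![p.1, p.2] : Fin 2 → ℝ) 1)) =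
      fun p => (α * |p.1|) * 1 + Real.sign p.1 * (β * p.2) := by
    ext p
    rw [← real_sign_mul_self]
    simp
    ring
  rw [e, integral_add ((integrable_id_gaussianReal.abs.const_mul α).mul_prod (integrable_const _))
    (hs.mul_prod (integrable_id_gaussianReal.const_mul β)),
    integral_prod_mul (fun x : ℝ => α * |x|) (fun _ : ℝ => (1 : ℝ)),
    integral_prod_mul Real.sign (fun y : ℝ => β * y), integral_const_mul, integral_const_mul,
    integral_id_gaussianReal]
  simp

/-- Grothendieck's identity in the plane, up to the value of the constant. -/
lemma exists_integral_sign_mul_sign_two :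
    ∃ M : ℝ, 0 < M ∧ ∀ c ∈ Set.Icc (-1 : ℝ) 1,
      ∫ z : Fin 2 → ℝ, Real.sign (z 0) * Real.sign (c * z 0 + √(1 - c ^ 2) * z 1)
        ∂(Measure.pi fun _ : Fin 2 => gaussianReal 0 1) = M * Real.arcsin c := by
  have hp := Real.pi_pos
  set w : ℝ → ℝ := fun ρ => ρ * ((√(2 * Real.pi))⁻¹ ^ 2 * Real.exp (-ρ ^ 2 / 2)) with hw
  -- In polar coordinates the radial factor separates from the angular one, which equals 4(π/2 -
  -- arccos c) = 4 arcsin c. Only the positivity of the radial integral matters.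
  refine ⟨4 * ∫ ρ in Set.Ioi (0 : ℝ), w ρ, ?_, ?_⟩
  · refine mul_pos (by norm_num) ?_
    have hI : IntegrableOn w (Set.Ioi 0) := by
      have := (integrable_mul_exp_neg_mul_sq (b := 1 / 2) (by norm_num)).const_mul
        ((√(2 * Real.pi))⁻¹ ^ 2)
      refine (this.congr (Filter.Eventually.of_forall fun x => ?_)).integrableOn
      simp only [hw]
      rw [show -x ^ 2 / 2 = -(1 / 2) * x ^ 2 by ring]
      ring
    refine (setIntegral_pos_iff_support_of_nonneg_ae ?_ hI).2 ?_
    · refine (ae_restrict_iff' measurableSet_Ioi).2 (Filter.Eventually.of_forall fun x hx => ?_)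
      have : (0 : ℝ) < x := hx
      simp only [hw, Pi.zero_apply]
      positivity
    · have : Function.support w ∩ Set.Ioi 0 = Set.Ioi 0 := by
        refine Set.inter_eq_right.2 fun x hx => ?_
        have : (0 : ℝ) < x := hx
        simp only [hw, Function.mem_support]
        positivity
      rw [this]
      simp
  · intro c hc
    set θ := Real.arccos c with hθ
    have hcos : c = Real.cos θ := (Real.cos_arccos hc.1 hc.2).symm
    have hsin : √(1 - c ^ 2) = Real.sin θ := (Real.sin_arccos c).symm
    set S : ℝ × ℝ → ℝ := fun p => Real.sign p.1 * Real.sign (c * p.1 + √(1 - c ^ 2) * p.2) with hS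
    have hSm : Measurable S :=
      (measurable_real_sign.comp measurable_fst).mul
        (measurable_real_sign.comp ((measurable_fst.const_mul c).add (measurable_snd.const_mul _)))
    have hSb : ∀ p, ‖S p‖ ≤ 1 := by
      intro p
      simp only [hS, Real.norm_eq_abs, abs_mul]
      exact mul_le_one₀ (abs_real_sign_le_one _) (abs_nonneg _) (abs_real_sign_le_one _)
    have hSi : Integrable S ((gaussianReal 0 1).prod (gaussianReal 0 1)) :=
      (integrable_const (1 : ℝ)).mono hSm.aestronglyMeasurable
        (Filter.Eventually.of_forall fun p => by simpa using hSb p)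
    set d := gaussianPDFReal 0 1 with hd
    have hdI : Integrable d := integrable_gaussianPDFReal 0 1
    have hDI : Integrable (fun p : ℝ × ℝ => d p.1 * d p.2 * S p) (volume.prod volume) := by
      refine (hdI.mul_prod hdI).mul_bdd (c := 1) hSm.aestronglyMeasurable
        (Filter.Eventually.of_forall hSb)
    have e1 : ∫ z : Fin 2 → ℝ, Real.sign (z 0) * Real.sign (c * z 0 + √(1 - c ^ 2) * z 1)
        ∂(Measure.pi fun _ : Fin 2 => gaussianReal 0 1) = ∫ p : ℝ × ℝ, d p.1 * d p.2 * S p := by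
      rw [integral_pi_gaussianReal_two]
      change ∫ p : ℝ × ℝ, S p ∂((gaussianReal 0 1).prod (gaussianReal 0 1)) = _
      rw [integral_prod _ hSi, Measure.volume_eq_prod, integral_prod _ hDI,
        integral_gaussianReal_eq_integral_smul one_ne_zero]
      congr 1
      ext x
      rw [integral_gaussianReal_eq_integral_smul one_ne_zero, smul_eq_mul, ← integral_const_mul]
      congr 1
      ext y
      simp only [smul_eq_mul, hd]
      ring
    rw [e1, ← integral_comp_polarCoord_symm]
    have e2 : ∀ p ∈ polarCoord.target,
        p.1 • (d (polarCoord.symm p).1 * d (polarCoord.symm p).2 * S (polarCoord.symm p)) =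
          w p.1 * (Real.sign (Real.cos p.2) * Real.sign (Real.cos (p.2 - θ))) := by
      rintro ⟨ρ, φ⟩ ⟨hρ, -⟩
      have hρ : 0 < ρ := hρ
      simp only [polarCoord_symm_apply, hS, smul_eq_mul]
      rw [hsin, hcos, real_sign_mul_of_pos hρ,
        show Real.cos θ * (ρ * Real.cos φ) + Real.sin θ * (ρ * Real.sin φ) =
          ρ * Real.cos (φ - θ) by rw [Real.cos_sub]; ring, real_sign_mul_of_pos hρ]
      have : d (ρ * Real.cos φ) * d (ρ * Real.sin φ) =
          (√(2 * Real.pi))⁻¹ ^ 2 * Real.exp (-ρ ^ 2 / 2) := by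
        simp only [hd, gaussianPDFReal, NNReal.coe_one, mul_one, sub_zero]
        rw [show -ρ ^ 2 / 2 = -(ρ * Real.cos φ) ^ 2 / 2 + -(ρ * Real.sin φ) ^ 2 / 2 by
          linear_combination (-ρ ^ 2 / 2) * (Real.sin_sq_add_cos_sq φ).symm, Real.exp_add]
        ring
      rw [this]
      simp only [hw]
      ring
    rw [setIntegral_congr_fun polarCoord.open_target.measurableSet e2]
    change ∫ p in Set.Ioi (0 : ℝ) ×ˢ Set.Ioo (-Real.pi) Real.pi, _ = _
    rw [Measure.volume_eq_prod, setIntegral_prod_mul w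
      (fun φ => Real.sign (Real.cos φ) * Real.sign (Real.cos (φ - θ))),
      ← integral_Ioc_eq_integral_Ioo, ← intervalIntegral.integral_of_le (by linarith),
      integral_sign_cos_mul_sign_cos (Real.arccos_nonneg c) (Real.arccos_le_pi c), Real.arccos]
    ring

/-! ### Gaussian matrices and the arcsine formula for E_r. -/

/-- The pair `(u · Z a, v · Z b)`. -/
noncomputable def bilinearPair {r : ℕ} {ι : Type*} [Fintype ι] (u v : Fin r → ℝ)
    (a b : EuclideanSpace ℝ ι) (Z : Fin r → ι → ℝ) : EuclideanSpace ℝ (Fin 2) :=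
  !₂[∑ i, u i * (Z i ⬝ᵥ a.ofLp), ∑ i, v i * (Z i ⬝ᵥ b.ofLp)]

lemma measurable_bilinearPair {r : ℕ} {ι : Type*} [Fintype ι] (u v : Fin r → ℝ)
    (a b : EuclideanSpace ℝ ι) : Measurable (bilinearPair u v a b) := by
  apply Continuous.measurable
  refine (PiLp.continuous_toLp 2 _).comp (continuous_pi fun i => ?_)
  fin_cases i <;> simp only [dotProduct] <;> fun_prop

instance isProbabilityMeasure_gaussianMatrix (r : ℕ) (ι : Type*) [Fintype ι] :
    IsProbabilityMeasure (gaussianMatrix r ι) := by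
  unfold gaussianMatrix
  infer_instance

/-- The rows of Z are independent, so the characteristic function is a product over rows, each
factor being given by `charFun_dotPair`. -/
lemma charFun_bilinearPair {r : ℕ} {ι : Type*} [Fintype ι] (u v : Fin r → ℝ)
    (a b : EuclideanSpace ℝ ι) (s : EuclideanSpace ℝ (Fin 2)) :
    charFun ((gaussianMatrix r ι).map (bilinearPair u v a b)) s =
      Complex.exp (-((∑ i, ‖(s 0 * u i) • a + (s 1 * v i) • b‖ ^ 2 : ℝ) : ℂ) / 2) := by
  have hrow : ∀ i, ∫ z, Complex.exp (((s 0 * u i) * (z ⬝ᵥ a.ofLp) +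
      (s 1 * v i) * (z ⬝ᵥ b.ofLp) : ℝ) * Complex.I)
        ∂(Measure.pi fun _ : ι => gaussianReal 0 1) =
      Complex.exp (-((‖(s 0 * u i) • a + (s 1 * v i) • b‖ ^ 2 : ℝ) : ℂ) / 2) := by
    intro i
    have h := charFun_dotPair a b !₂[s 0 * u i, s 1 * v i]
    rw [charFun_apply, integral_map (measurable_dotPair a b).aemeasurable (by fun_prop)] at h
    simp only [dotPair, PiLp.inner_apply, Fin.sum_univ_two] at h
    simp at h
    simpa [mul_comm] using h
  rw [charFun_apply, integral_map (measurable_bilinearPair u v a b).aemeasurable (by fun_prop)]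
  have e : ∀ Z : Fin r → ι → ℝ, Complex.exp ((inner ℝ (bilinearPair u v a b Z) s : ℝ) * Complex.I)
      = ∏ i, Complex.exp (((s 0 * u i) * (Z i ⬝ᵥ a.ofLp) +
      (s 1 * v i) * (Z i ⬝ᵥ b.ofLp) : ℝ) * Complex.I) := by
    intro Z
    rw [← Complex.exp_sum, ← Finset.sum_mul, ← Complex.ofReal_sum, Finset.sum_add_distrib]
    simp only [bilinearPair, PiLp.inner_apply, Fin.sum_univ_two]
    simp [Finset.mul_sum, mul_comm, mul_assoc, mul_left_comm]
  simp_rw [e]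
  rw [gaussianMatrix, integral_fintype_prod_eq_prod (f := fun i (z : ι → ℝ) =>
    Complex.exp (((s 0 * u i) * (z ⬝ᵥ a.ofLp) + (s 1 * v i) * (z ⬝ᵥ b.ofLp) : ℝ) * Complex.I))]
  simp_rw [hrow]
  rw [← Complex.exp_sum]
  congr 1
  push_cast
  rw [← Finset.sum_div, Finset.sum_neg_distrib]

lemma norm_planar_unit {c : ℝ} (hc : c ∈ Set.Icc (-1 : ℝ) 1) :
    ‖(!₂[c, √(1 - c ^ 2)] : EuclideanSpace ℝ (Fin 2))‖ = 1 := by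
  have : 0 ≤ 1 - c ^ 2 := by nlinarith [hc.1, hc.2]
  simp [EuclideanSpace.norm_eq, Fin.sum_univ_two, Real.sq_sqrt this]

lemma norm_planar_fst : ‖(!₂[1, 0] : EuclideanSpace ℝ (Fin 2))‖ = 1 := by
  simp [EuclideanSpace.norm_eq, Fin.sum_univ_two]

lemma inner_planar (c d : ℝ) :
    inner ℝ (!₂[1, 0] : EuclideanSpace ℝ (Fin 2)) !₂[c, d] = c := by
  simp [PiLp.inner_apply, Fin.sum_univ_two]

lemma mem_Icc_inner_of_norm_eq_one {ι : Type*} [Fintype ι] {a b : EuclideanSpace ℝ ι}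
    (ha : ‖a‖ = 1) (hb : ‖b‖ = 1) : inner ℝ a b ∈ Set.Icc (-1 : ℝ) 1 := by
  have := abs_real_inner_le_norm a b
  rw [ha, hb, one_mul] at this
  exact abs_le.1 this

/-- For unit vectors `u`, `v`, `a`, `b` the pair `(u · Z a, v · Z b)` is a standard Gaussian pair
with correlation `(u · v) (a · b)`. -/
lemma map_bilinearPair {r : ℕ} {ι : Type*} [Fintype ι] (u v : EuclideanSpace ℝ (Fin r))
    (a b : EuclideanSpace ℝ ι) (hu : ‖u‖ = 1) (hv : ‖v‖ = 1) (ha : ‖a‖ = 1) (hb : ‖b‖ = 1) {c : ℝ}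
    (hc : c = inner ℝ a b * inner ℝ u v) :
    (gaussianMatrix r ι).map (bilinearPair u.ofLp v.ofLp a b) =
      (Measure.pi fun _ : Fin 2 => gaussianReal 0 1).map (dotPair !₂[1, 0] !₂[c, √(1 - c ^ 2)]) := by
  have hcm : c ∈ Set.Icc (-1 : ℝ) 1 := by
    have h1 := mem_Icc_inner_of_norm_eq_one ha hb
    have h2 := mem_Icc_inner_of_norm_eq_one hu hv
    rw [Set.mem_Icc, ← abs_le] at h1 h2 ⊢
    rw [hc, abs_mul]
    exact mul_le_one₀ h1 (abs_nonneg _) h2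
  have : IsProbabilityMeasure ((gaussianMatrix r ι).map (bilinearPair u.ofLp v.ofLp a b)) :=
    Measure.isProbabilityMeasure_map (measurable_bilinearPair _ _ _ _).aemeasurable
  apply Measure.ext_of_charFun
  ext s
  rw [charFun_bilinearPair, charFun_dotPair]
  have h : ∑ i, ‖(s 0 * u i) • a + (s 1 * v i) • b‖ ^ 2 =
      ‖s 0 • (!₂[1, 0] : EuclideanSpace ℝ (Fin 2)) + s 1 • !₂[c, √(1 - c ^ 2)]‖ ^ 2 := by
    have hu2 : ∑ i, u i ^ 2 = 1 := by rw [← EuclideanSpace.real_norm_sq_eq, hu, one_pow]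
    have hv2 : ∑ i, v i ^ 2 = 1 := by rw [← EuclideanSpace.real_norm_sq_eq, hv, one_pow]
    have huv : ∑ i, u i * v i = inner ℝ u v := by
      simp [PiLp.inner_apply, mul_comm]
    rw [norm_add_sq_real, norm_smul, norm_smul, inner_smul_left, inner_smul_right, norm_planar_fst,
      norm_planar_unit hcm, inner_planar, hc, ← huv]
    simp_rw [norm_add_sq_real, norm_smul, inner_smul_left, inner_smul_right, ha, hb, mul_one,
      Finset.sum_add_distrib, Real.norm_eq_abs, sq_abs, mul_pow, ← Finset.mul_sum, hu2, hv2]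
    have hcross : ∑ i, 2 * (s 0 * u i * (s 1 * v i * inner ℝ a b)) =
        2 * (s 0 * (s 1 * (inner ℝ a b * ∑ i, u i * v i))) := by
      simp only [Finset.mul_sum]
      exact Finset.sum_congr rfl fun i _ => by ring
    simp only [conj_trivial, Finset.mul_sum] at hcross ⊢
    linarith
  rw [h]
  push_cast
  rfl

/-- The law of a standard Gaussian vector with `r` coordinates. -/
noncomputable abbrev gaussianVector (r : ℕ) : Measure (Fin r → ℝ) :=
  Measure.pi fun _ => gaussianReal 0 1

/-- The cosine of the angle between two vectors of `ℝʳ`. -/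
noncomputable def dirCos {r : ℕ} (p : (Fin r → ℝ) × (Fin r → ℝ)) : ℝ :=
  (p.1 ⬝ᵥ p.2) / (‖WithLp.toLp 2 p.1‖ * ‖WithLp.toLp 2 p.2‖)

lemma inner_toLp {r : ℕ} (x y : Fin r → ℝ) :
    inner ℝ (WithLp.toLp 2 x) (WithLp.toLp 2 y) = x ⬝ᵥ y := by
  simp [PiLp.inner_apply, dotProduct, mul_comm]

lemma abs_dirCos_le_one {r : ℕ} (p : (Fin r → ℝ) × (Fin r → ℝ)) : |dirCos p| ≤ 1 := by
  rw [dirCos, ← inner_toLp]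
  exact abs_real_inner_div_norm_mul_norm_le_one _ _

lemma continuous_dotProduct_pair (r : ℕ) :
    Continuous fun p : (Fin r → ℝ) × (Fin r → ℝ) => p.1 ⬝ᵥ p.2 := by
  simp only [dotProduct]
  fun_prop

lemma measurable_dirCos (r : ℕ) :
    Measurable (dirCos : (Fin r → ℝ) × (Fin r → ℝ) → ℝ) := by
  unfold dirCos
  refine (continuous_dotProduct_pair r).measurable.div ?_
  exact Continuous.measurable (by fun_prop)

lemma dotProduct_mul_dirCos_nonneg {r : ℕ} (p : (Fin r → ℝ) × (Fin r → ℝ)) :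
    0 ≤ (p.1 ⬝ᵥ p.2) * dirCos p := by
  rw [dirCos, ← mul_div_assoc]
  exact div_nonneg (mul_self_nonneg _) (by positivity)

lemma dotProduct_mul_dirCos_pos {r : ℕ} {p : (Fin r → ℝ) × (Fin r → ℝ)} (hp : p.1 ⬝ᵥ p.2 ≠ 0) :
    0 < (p.1 ⬝ᵥ p.2) * dirCos p := by
  rw [dirCos, ← mul_div_assoc]
  have h1 : WithLp.toLp 2 p.1 ≠ 0 := by
    intro h
    apply hp
    rw [← inner_toLp, h, inner_zero_left]
  have h2 : WithLp.toLp 2 p.2 ≠ 0 := by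
    intro h
    apply hp
    rw [← inner_toLp, h, inner_zero_right]
  exact div_pos (mul_self_pos.2 hp) (mul_pos (norm_pos_iff.2 h1) (norm_pos_iff.2 h2))

lemma integrable_eval_gaussianVector {r : ℕ} (i : Fin r) :
    Integrable (fun U : Fin r → ℝ => U i) (gaussianVector r) :=
  integrable_comp_eval (μ := fun _ : Fin r => gaussianReal 0 1) (f := fun x : ℝ => x)
    integrable_id_gaussianReal

lemma integrable_dotProduct (r : ℕ) :
    Integrable (fun p : (Fin r → ℝ) × (Fin r → ℝ) => p.1 ⬝ᵥ p.2)
      ((gaussianVector r).prod (gaussianVector r)) := by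
  simp only [dotProduct]
  exact integrable_finsetSum _ fun i _ =>
    (integrable_eval_gaussianVector i).mul_prod (integrable_eval_gaussianVector i)

lemma measurable_sign_dotProduct {r : ℕ} (X : Fin r → ℝ) :
    Measurable fun U : Fin r → ℝ => Real.sign (U ⬝ᵥ X) := by
  refine measurable_real_sign.comp (Continuous.measurable ?_)
  simp only [dotProduct]
  fun_prop

/-- A vector is recovered, up to scale, as the Gaussian average of `sign (U · X) U`. -/
lemma integral_sign_dotProduct_mul_eval {r : ℕ} (X : EuclideanSpace ℝ (Fin r)) (i : Fin r) :
    ∫ U, Real.sign (U ⬝ᵥ X.ofLp) * U i ∂(gaussianVector r) =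
      (∫ x, |x| ∂(gaussianReal 0 1)) * (‖X‖⁻¹ • X) i := by
  by_cases hX : X = 0
  · simp [hX]
  have hn : 0 < ‖X‖⁻¹ := inv_pos.2 (norm_pos_iff.2 hX)
  set a := ‖X‖⁻¹ • X with ha
  have ha1 : ‖a‖ = 1 := norm_smul_inv_norm hX
  set e : EuclideanSpace ℝ (Fin r) := EuclideanSpace.single i 1 with he
  have he1 : ‖e‖ = 1 := by simp [he]
  have hae : inner ℝ a e = a i := by simp [he, EuclideanSpace.inner_single_right]
  have hm := mem_Icc_inner_of_norm_eq_one ha1 he1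
  rw [hae] at hm
  have hlaw := map_dotPair_congr a e !₂[1, 0] !₂[a i, √(1 - a i ^ 2)] ha1 he1 norm_planar_fst
    (norm_planar_unit hm) (by rw [inner_planar, hae])
  have hF : Measurable fun q : EuclideanSpace ℝ (Fin 2) => Real.sign (q 0) * q 1 :=
    (measurable_real_sign.comp (by fun_prop)).mul (by fun_prop)
  have h1 := integral_map (μ := gaussianVector r) (measurable_dotPair a e).aemeasurable
    hF.aestronglyMeasurable
  have h2 := integral_map (μ := gaussianVector 2)
    (measurable_dotPair !₂[1, 0] !₂[a i, √(1 - a i ^ 2)]).aemeasurable hF.aestronglyMeasurable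
  have h3 := integral_sign_mul_gaussian_two (a i) √(1 - a i ^ 2)
  rw [hlaw, h2] at h1
  rw [mul_comm, ← h3]
  refine Eq.trans ?_ (h1.symm.trans ?_)
  · congr 1
    ext U
    have : (dotPair a e U) 0 = ‖X‖⁻¹ * (U ⬝ᵥ X.ofLp) := by
      simp [dotPair, ha]
    have h' : (dotPair a e U) 1 = U i := by
      simp [dotPair, he]
    rw [this, h', real_sign_mul_of_pos hn]
  · congr 1
    ext z
    simp [dotPair, dotProduct, Fin.sum_univ_two, mul_comm]

/-- Grothendieck's identity for Gaussian matrices, up to the value of the constant. -/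
lemma exists_integral_sign_bilinear :
    ∃ M : ℝ, 0 < M ∧ ∀ (r : ℕ) (ι : Type) [Fintype ι] (a b : EuclideanSpace ℝ ι)
      (p : (Fin r → ℝ) × (Fin r → ℝ)), ‖a‖ = 1 → ‖b‖ = 1 → p.1 ⬝ᵥ p.2 ≠ 0 →
      ∫ Z, Real.sign (∑ i, p.1 i * (Z i ⬝ᵥ a.ofLp)) * Real.sign (∑ i, p.2 i * (Z i ⬝ᵥ b.ofLp))
        ∂(gaussianMatrix r ι) = M * Real.arcsin (inner ℝ a b * dirCos p) := by
  obtain ⟨M, hM, h⟩ := exists_integral_sign_mul_sign_two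
  refine ⟨M, hM, ?_⟩
  intro r ι _ a b p ha hb hp
  set x := WithLp.toLp 2 p.1 with hx
  set y := WithLp.toLp 2 p.2 with hy
  have hx0 : x ≠ 0 := by
    intro h
    apply hp
    rw [← inner_toLp, ← hx, h, inner_zero_left]
  have hy0 : y ≠ 0 := by
    intro h
    apply hp
    rw [← inner_toLp, ← hy, h, inner_zero_right]
  set u := ‖x‖⁻¹ • x with hu
  set v := ‖y‖⁻¹ • y with hv
  have hu1 : ‖u‖ = 1 := norm_smul_inv_norm hx0
  have hv1 : ‖v‖ = 1 := norm_smul_inv_norm hy0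
  have hdir : inner ℝ u v = dirCos p := by
    rw [hu, hv, inner_smul_left, inner_smul_right, dirCos, inner_toLp, ← hx, ← hy]
    simp only [conj_trivial]
    field_simp
  set c := inner ℝ a b * inner ℝ u v with hc
  have hcm : c ∈ Set.Icc (-1 : ℝ) 1 := by
    have h1 := mem_Icc_inner_of_norm_eq_one ha hb
    have h2 := mem_Icc_inner_of_norm_eq_one hu1 hv1
    rw [Set.mem_Icc, ← abs_le] at h1 h2 ⊢
    rw [hc, abs_mul]
    exact mul_le_one₀ h1 (abs_nonneg _) h2
  have hlaw := map_bilinearPair u v a b hu1 hv1 ha hb hc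
  have hF : Measurable fun q : EuclideanSpace ℝ (Fin 2) => Real.sign (q 0) * Real.sign (q 1) :=
    (measurable_real_sign.comp (by fun_prop)).mul (measurable_real_sign.comp (by fun_prop))
  have h1 := integral_map (μ := gaussianMatrix r ι)
    (measurable_bilinearPair u.ofLp v.ofLp a b).aemeasurable hF.aestronglyMeasurable
  have h2 := integral_map (μ := gaussianVector 2)
    (measurable_dotPair !₂[1, 0] !₂[c, √(1 - c ^ 2)]).aemeasurable hF.aestronglyMeasurable
  rw [hlaw, h2] at h1
  rw [← hdir, ← hc, ← h c hcm]
  refine Eq.trans ?_ (h1.symm.trans ?_)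
  · congr 1
    ext Z
    have e1 : (bilinearPair u.ofLp v.ofLp a b Z) 0 = ‖x‖⁻¹ * ∑ i, p.1 i * (Z i ⬝ᵥ a.ofLp) := by
      simp [bilinearPair, hu, hx, Finset.mul_sum, mul_assoc]
    have e2 : (bilinearPair u.ofLp v.ofLp a b Z) 1 = ‖y‖⁻¹ * ∑ i, p.2 i * (Z i ⬝ᵥ b.ofLp) := by
      simp [bilinearPair, hv, hy, Finset.mul_sum, mul_assoc]
    rw [e1, e2, real_sign_mul_of_pos (inv_pos.2 (norm_pos_iff.2 hx0)),
      real_sign_mul_of_pos (inv_pos.2 (norm_pos_iff.2 hy0))]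
  · congr 1
    ext z
    simp [dotPair, dotProduct, Fin.sum_univ_two, mul_comm]

/-- The arcsine formula for `E_r`. -/
lemma exists_E_eq_integral_arcsin (r : ℕ) :
    ∃ K : ℝ, 0 < K ∧ ∀ t ∈ Set.Icc (-1 : ℝ) 1,
      E r t = K * ∫ p, (p.1 ⬝ᵥ p.2) * Real.arcsin (t * dirCos p)
        ∂((gaussianVector r).prod (gaussianVector r)) := by
  obtain ⟨M, hM, hG⟩ := exists_integral_sign_bilinear
  set κ := ∫ x, |x| ∂(gaussianReal 0 1) with hκ
  have hκ0 : 0 < κ := integral_abs_gaussianReal_pos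
  refine ⟨κ⁻¹ ^ 2 * M, by positivity, ?_⟩
  intro t ht
  set a : EuclideanSpace ℝ (Fin 2) := !₂[1, 0] with ha
  set b : EuclideanSpace ℝ (Fin 2) := !₂[t, √(1 - t ^ 2)] with hb
  have ha1 : ‖a‖ = 1 := norm_planar_fst
  have hb1 : ‖b‖ = 1 := norm_planar_unit ht
  have hab : inner ℝ a b = t := inner_planar _ _
  set μ := gaussianVector r
  set s : (Fin r → Fin 2 → ℝ) → (Fin r → ℝ) × (Fin r → ℝ) → ℝ := fun Z p =>
    Real.sign (∑ i, p.1 i * (Z i ⬝ᵥ a.ofLp)) * Real.sign (∑ i, p.2 i * (Z i ⬝ᵥ b.ofLp)) with hs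
  have hsm : Measurable (Function.uncurry s) := by
    refine (measurable_real_sign.comp (Continuous.measurable ?_)).mul
      (measurable_real_sign.comp (Continuous.measurable ?_)) <;>
    · simp only [dotProduct]
      fun_prop
  have hsb : ∀ q, ‖Function.uncurry s q‖ ≤ 1 := by
    rintro ⟨Z, p⟩
    simp only [Function.uncurry, hs, Real.norm_eq_abs, abs_mul]
    exact mul_le_one₀ (abs_real_sign_le_one _) (abs_nonneg _) (abs_real_sign_le_one _)
  -- For fixed Z, each normalized image is κ⁻¹ times a Gaussian average of sign(U·X) U; independent
  -- copies U, V for the two images turn the inner product into one double integral.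
  have hpt : ∀ Z : Fin r → Fin 2 → ℝ, inner ℝ (normalizedImage Z a) (normalizedImage Z b) =
      κ⁻¹ ^ 2 * ∫ p, s Z p * (p.1 ⬝ᵥ p.2) ∂(μ.prod μ) := by
    intro Z
    set X : EuclideanSpace ℝ (Fin r) := WithLp.toLp 2 ((Matrix.of Z).mulVec a.ofLp) with hX
    set Y : EuclideanSpace ℝ (Fin r) := WithLp.toLp 2 ((Matrix.of Z).mulVec b.ofLp) with hY
    have hsum : ∫ p, s Z p * (p.1 ⬝ᵥ p.2) ∂(μ.prod μ) =
        ∑ i, ∫ p, (Real.sign (p.1 ⬝ᵥ X.ofLp) * p.1 i) * (Real.sign (p.2 ⬝ᵥ Y.ofLp) * p.2 i)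
          ∂(μ.prod μ) := by
      rw [← integral_finsetSum]
      · congr 1
        ext p
        simp only [hs, dotProduct, hX, hY, Matrix.mulVec, Matrix.of_apply, Finset.mul_sum]
        exact Finset.sum_congr rfl fun i _ => by ring
      · intro i _
        have hi : ∀ W : Fin r → ℝ, Integrable (fun U : Fin r → ℝ => Real.sign (U ⬝ᵥ W) * U i) μ :=
          fun W => (integrable_eval_gaussianVector i).bdd_mul (c := 1)
            (measurable_sign_dotProduct W).aestronglyMeasurable
            (Filter.Eventually.of_forall fun U => abs_real_sign_le_one _)
        exact (hi _).mul_prod (hi _)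
    rw [hsum]
    have hprod : ∀ i, ∫ p, (Real.sign (p.1 ⬝ᵥ X.ofLp) * p.1 i) * (Real.sign (p.2 ⬝ᵥ Y.ofLp) * p.2 i)
        ∂(μ.prod μ) = (κ * (‖X‖⁻¹ • X) i) * (κ * (‖Y‖⁻¹ • Y) i) := by
      intro i
      rw [integral_prod_mul (fun U : Fin r → ℝ => Real.sign (U ⬝ᵥ X.ofLp) * U i)
        (fun U : Fin r → ℝ => Real.sign (U ⬝ᵥ Y.ofLp) * U i), integral_sign_dotProduct_mul_eval,
        integral_sign_dotProduct_mul_eval]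
    have : inner ℝ (normalizedImage Z a) (normalizedImage Z b) =
        ∑ i, (‖X‖⁻¹ • X) i * (‖Y‖⁻¹ • Y) i := by
      change inner ℝ (‖X‖⁻¹ • X) (‖Y‖⁻¹ • Y) = _
      rw [PiLp.inner_apply]
      simp [mul_comm]
    simp_rw [hprod]
    rw [this, Finset.mul_sum]
    refine Finset.sum_congr rfl fun i _ => ?_
    field_simp
  have hInt : Integrable (Function.uncurry fun (Z : Fin r → Fin 2 → ℝ)
      (p : (Fin r → ℝ) × (Fin r → ℝ)) => s Z p * (p.1 ⬝ᵥ p.2))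
      ((gaussianMatrix r (Fin 2)).prod (μ.prod μ)) :=
    ((integrable_dotProduct r).comp_snd (gaussianMatrix r (Fin 2))).bdd_mul (c := 1)
      hsm.aestronglyMeasurable (Filter.Eventually.of_forall hsb)
  change ∫ Z, inner ℝ (normalizedImage Z a) (normalizedImage Z b) ∂(gaussianMatrix r (Fin 2)) = _
  rw [integral_congr_ae (Filter.Eventually.of_forall hpt)]
  rw [integral_const_mul, integral_integral_swap hInt, mul_assoc, ← integral_const_mul M]
  congr 2
  ext p
  -- Orthogonal pairs, zero vectors included, carry weight zero; this disposes of the case excluded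
  -- from the sign identity.
  by_cases hp : p.1 ⬝ᵥ p.2 = 0
  · simp [hp]
  · rw [integral_mul_const, hG r (Fin 2) a b p ha1 hb1 hp, hab]
    ring

/-! ### Continuity, oddness and strict monotonicity of E_r. -/

/-- The non-orthogonal pairs form an open set, nonempty because r ≥ 1, and a Gaussian measure
charges every nonempty open set. -/
lemma integral_pos_of_pos_of_dotProduct_ne_zero {r : ℕ} (hr : 1 ≤ r)
    {f : (Fin r → ℝ) × (Fin r → ℝ) → ℝ}
    (hf : Integrable f ((gaussianVector r).prod (gaussianVector r))) (h0 : ∀ p, 0 ≤ f p)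
    (hpos : ∀ p, p.1 ⬝ᵥ p.2 ≠ 0 → 0 < f p) :
    0 < ∫ p, f p ∂((gaussianVector r).prod (gaussianVector r)) := by
  refine (integral_pos_iff_support_of_nonneg h0 hf).2 ?_
  have : (gaussianReal 0 1).IsOpenPosMeasure :=
    (gaussianReal_absolutelyContinuous' 0 one_ne_zero).isOpenPosMeasure
  have : (gaussianVector r).IsOpenPosMeasure := Measure.pi.isOpenPosMeasure _
  have : ((gaussianVector r).prod (gaussianVector r)).IsOpenPosMeasure :=
    Measure.prod.instIsOpenPosMeasure
  have hopen : IsOpen {p : (Fin r → ℝ) × (Fin r → ℝ) | p.1 ⬝ᵥ p.2 ≠ 0} :=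
    isOpen_ne_fun (continuous_dotProduct_pair r) continuous_const
  have hne : {p : (Fin r → ℝ) × (Fin r → ℝ) | p.1 ⬝ᵥ p.2 ≠ 0}.Nonempty := by
    refine ⟨(fun _ => 1, fun _ => 1), ?_⟩
    simp only [Set.mem_ofPred_eq, dotProduct, mul_one, Finset.sum_const, Finset.card_univ,
      Fintype.card_fin, nsmul_eq_mul, Nat.cast_ne_zero]
    lia
  exact (hopen.measure_pos _ hne).trans_le (measure_mono fun p hp => (hpos p hp).ne')

lemma abs_arcsin_le (x : ℝ) : |Real.arcsin x| ≤ Real.pi / 2 :=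
  abs_le.2 ⟨Real.neg_pi_div_two_le_arcsin x, Real.arcsin_le_pi_div_two x⟩

lemma measurable_dotProduct_mul_arcsin (r : ℕ) (t : ℝ) :
    Measurable fun p : (Fin r → ℝ) × (Fin r → ℝ) =>
      (p.1 ⬝ᵥ p.2) * Real.arcsin (t * dirCos p) :=
  (continuous_dotProduct_pair r).measurable.mul
    (Real.measurable_arcsin.comp ((measurable_dirCos r).const_mul t))

lemma integrable_dotProduct_mul_arcsin (r : ℕ) (t : ℝ) :
    Integrable (fun p : (Fin r → ℝ) × (Fin r → ℝ) =>
      (p.1 ⬝ᵥ p.2) * Real.arcsin (t * dirCos p)) ((gaussianVector r).prod (gaussianVector r)) :=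
  (integrable_dotProduct r).mul_bdd (c := Real.pi / 2)
    (Real.measurable_arcsin.comp ((measurable_dirCos r).const_mul t)).aestronglyMeasurable
    (Filter.Eventually.of_forall fun _ => abs_arcsin_le _)

lemma continuousOn_E (r : ℕ) : ContinuousOn (E r) (Set.Icc (-1) 1) := by
  obtain ⟨K, -, hE⟩ := exists_E_eq_integral_arcsin r
  refine ContinuousOn.congr (Continuous.continuousOn ?_) hE
  refine continuous_const.mul (continuous_of_dominated
    (bound := fun p => ‖p.1 ⬝ᵥ p.2‖ * (Real.pi / 2)) ?_ ?_ ?_ ?_)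
  · exact fun t => (measurable_dotProduct_mul_arcsin r t).aestronglyMeasurable
  · refine fun t => Filter.Eventually.of_forall fun p => ?_
    rw [norm_mul]
    exact mul_le_mul_of_nonneg_left (abs_arcsin_le _) (norm_nonneg _)
  · exact (integrable_dotProduct r).norm.mul_const _
  · exact Filter.Eventually.of_forall fun p =>
      continuous_const.mul (Real.continuous_arcsin.comp (continuous_id.mul continuous_const))

lemma E_neg (r : ℕ) {t : ℝ} (ht : t ∈ Set.Icc (-1 : ℝ) 1) : E r (-t) = -E r t := by
  obtain ⟨K, -, hE⟩ := exists_E_eq_integral_arcsin r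
  rw [hE t ht, hE (-t) ⟨by linarith [ht.2], by linarith [ht.1]⟩]
  simp only [neg_mul, Real.arcsin_neg, mul_neg, integral_neg]

/-- The factor U·V and the cosine share their sign, so (U·V) arcsin(t cos) increases with t for
every non-orthogonal pair. -/
lemma strictMonoOn_E {r : ℕ} (hr : 1 ≤ r) : StrictMonoOn (E r) (Set.Icc (-1) 1) := by
  obtain ⟨K, hK, hE⟩ := exists_E_eq_integral_arcsin r
  intro t ht t' ht' htt
  rw [hE t ht, hE t' ht']
  refine mul_lt_mul_of_pos_left ?_ hK
  rw [← sub_pos, ← integral_sub (integrable_dotProduct_mul_arcsin r t')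
    (integrable_dotProduct_mul_arcsin r t)]
  have hmem : ∀ {s : ℝ}, s ∈ Set.Icc (-1 : ℝ) 1 → ∀ p : (Fin r → ℝ) × (Fin r → ℝ),
      s * dirCos p ∈ Set.Icc (-1 : ℝ) 1 := by
    intro s hs p
    rw [Set.mem_Icc, ← abs_le] at hs ⊢
    rw [abs_mul]
    exact mul_le_one₀ hs (abs_nonneg _) (abs_dirCos_le_one p)
  have hpos : ∀ p : (Fin r → ℝ) × (Fin r → ℝ), p.1 ⬝ᵥ p.2 ≠ 0 →
      0 < (p.1 ⬝ᵥ p.2) * Real.arcsin (t' * dirCos p) -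
        (p.1 ⬝ᵥ p.2) * Real.arcsin (t * dirCos p) := by
    intro p hp
    rw [← mul_sub]
    rcases pos_and_pos_or_neg_and_neg_of_mul_pos (dotProduct_mul_dirCos_pos hp) with h | h
    · refine mul_pos h.1 (sub_pos.2 (Real.strictMonoOn_arcsin (hmem ht p) (hmem ht' p) ?_))
      exact mul_lt_mul_of_pos_right htt h.2
    · refine mul_pos_of_neg_of_neg h.1 (sub_neg.2
        (Real.strictMonoOn_arcsin (hmem ht' p) (hmem ht p) ?_))
      exact mul_lt_mul_of_neg_right htt h.2
  refine integral_pos_of_pos_of_dotProduct_ne_zero hr ((integrable_dotProduct_mul_arcsin r t').sub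
    (integrable_dotProduct_mul_arcsin r t)) (fun p => ?_) hpos
  by_cases hp : p.1 ⬝ᵥ p.2 = 0
  · simp [hp]
  · exact (hpos p hp).le

/-! ### Holomorphic extension of E_r and its inverse. -/

lemma norm_mul_dirCos_le {r : ℕ} (w : ℂ) (p : (Fin r → ℝ) × (Fin r → ℝ)) :
    ‖w * (dirCos p : ℂ)‖ ≤ ‖w‖ := by
  rw [norm_mul, Complex.norm_real]
  exact mul_le_of_le_one_right (norm_nonneg _) (abs_dirCos_le_one p)

/-- The integrand of the derivative of the analytic continuation of `E_r`. -/
noncomputable def extensionDerivIntegrand {r : ℕ} (w : ℂ) (p : (Fin r → ℝ) × (Fin r → ℝ)) : ℂ :=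
  ((p.1 ⬝ᵥ p.2) * dirCos p : ℝ) * ((1 - (w * dirCos p) ^ 2) ^ (1 / 2 : ℂ))⁻¹

/-- `E_r` extends to a holomorphic function on the unit disc whose derivative has positive real
part. -/
lemma exists_holomorphic_extension {r : ℕ} (hr : 1 ≤ r) :
    ∃ F F' : ℂ → ℂ, (∀ w, ‖w‖ < 1 → HasDerivAt F (F' w) w) ∧ (∀ w, ‖w‖ < 1 → 0 < (F' w).re) ∧
      ∀ t : ℝ, |t| < 1 → F t = E r t := by
  obtain ⟨K, hK, hE⟩ := exists_E_eq_integral_arcsin r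
  set μ := (gaussianVector r).prod (gaussianVector r) with hμ
  set F : ℂ → (Fin r → ℝ) × (Fin r → ℝ) → ℂ := fun w p =>
    ((p.1 ⬝ᵥ p.2 : ℝ) : ℂ) * cArcsin (w * dirCos p) with hF
  have hdm : Measurable fun p : (Fin r → ℝ) × (Fin r → ℝ) => (dirCos p : ℂ) :=
    Complex.measurable_ofReal.comp (measurable_dirCos r)
  have hwm : Measurable fun p : (Fin r → ℝ) × (Fin r → ℝ) => ((p.1 ⬝ᵥ p.2 : ℝ) : ℂ) :=
    Complex.measurable_ofReal.comp (continuous_dotProduct_pair r).measurable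
  have hFm : ∀ w, Measurable (F w) := fun w =>
    hwm.mul (measurable_cArcsin.comp (hdm.const_mul w))
  have hF'm : ∀ w : ℂ, Measurable (extensionDerivIntegrand w :
      (Fin r → ℝ) × (Fin r → ℝ) → ℂ) := by
    intro w
    refine (Complex.measurable_ofReal.comp ((continuous_dotProduct_pair r).measurable.mul
      (measurable_dirCos r))).mul ?_
    exact (((((hdm.const_mul w).pow_const 2).const_sub 1).pow_const _)).inv
  have hFi : ∀ w, ‖w‖ < 1 → Integrable (F w) μ := by
    intro w hw
    refine (integrable_dotProduct r).ofReal.mul_bdd (c := (1 - ‖w‖ ^ 2)⁻¹)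
      (measurable_cArcsin.comp (hdm.const_mul w)).aestronglyMeasurable
      (Filter.Eventually.of_forall fun p => norm_cArcsin_le (norm_mul_dirCos_le w p) hw)
  have hbound : ∀ {w : ℂ} {ρ : ℝ}, ‖w‖ ≤ ρ → ρ < 1 → ∀ p : (Fin r → ℝ) × (Fin r → ℝ),
      ‖extensionDerivIntegrand w p‖ ≤ ‖p.1 ⬝ᵥ p.2‖ * (1 - ρ ^ 2)⁻¹ := by
    intro w ρ hw hρ p
    rw [extensionDerivIntegrand, norm_mul, Complex.norm_real, norm_mul]
    refine mul_le_mul (mul_le_of_le_one_right (norm_nonneg _) (abs_dirCos_le_one p))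
      (norm_inv_cpow_half_le ((norm_mul_dirCos_le w p).trans hw) hρ) (norm_nonneg _) (norm_nonneg _)
  have hder : ∀ w : ℂ, ‖w‖ < 1 → Integrable (extensionDerivIntegrand w) μ ∧
      HasDerivAt (fun w => ∫ p, F w p ∂μ) (∫ p, extensionDerivIntegrand w p ∂μ) w := by
    intro w hw
    -- Midway between ‖w‖ and 1: a ball about w then stays in ‖x‖ ≤ ρ < 1, where one bound dominates
    -- all derivatives.
    set ρ := (1 + ‖w‖) / 2 with hρ
    have hball : ∀ x ∈ Metric.ball w ((1 - ‖w‖) / 2), ‖x‖ ≤ ρ := by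
      intro x hx
      rw [Metric.mem_ball, dist_eq_norm] at hx
      have := norm_add_le (x - w) w
      rw [sub_add_cancel] at this
      linarith
    refine hasDerivAt_integral_of_dominated_loc_of_deriv_le
      (bound := fun p => ‖p.1 ⬝ᵥ p.2‖ * (1 - ρ ^ 2)⁻¹)
      (Metric.ball_mem_nhds w (by linarith : 0 < (1 - ‖w‖) / 2))
      (Filter.Eventually.of_forall fun x => (hFm x).aestronglyMeasurable) (hFi w hw)
      (hF'm w).aestronglyMeasurable
      (Filter.Eventually.of_forall fun p x hx => hbound (hball x hx) (by linarith) p)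
      ((integrable_dotProduct r).norm.mul_const _)
      (Filter.Eventually.of_forall fun p x hx => ?_)
    have hx1 : ‖x * (dirCos p : ℂ)‖ < 1 :=
      (norm_mul_dirCos_le x p).trans_lt ((hball x hx).trans_lt (by linarith))
    have h1 : HasDerivAt (fun x : ℂ => x * (dirCos p : ℂ)) (dirCos p : ℂ) x := by
      simpa using (hasDerivAt_id x).mul_const (dirCos p : ℂ)
    refine (((hasDerivAt_cArcsin hx1).comp x h1).const_mul ((p.1 ⬝ᵥ p.2 : ℝ) : ℂ)).congr_deriv ?_
    rw [extensionDerivIntegrand]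
    push_cast
    ring
  refine ⟨fun w => K * ∫ p, F w p ∂μ, fun w => K * ∫ p, extensionDerivIntegrand w p ∂μ,
    fun w hw => (hder w hw).2.const_mul _, fun w hw => ?_, fun t ht => ?_⟩
  · rw [Complex.re_ofReal_mul]
    refine mul_pos hK ?_
    have hi := (hder w hw).1
    have hre : (∫ p, extensionDerivIntegrand w p ∂μ).re =
        ∫ p, (extensionDerivIntegrand w p).re ∂μ := (integral_re hi).symm
    rw [hre]
    have hq : ∀ p : (Fin r → ℝ) × (Fin r → ℝ),
        0 < (((1 - (w * dirCos p) ^ 2) ^ (1 / 2 : ℂ))⁻¹).re := fun p =>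
      inv_cpow_half_re_pos ((norm_mul_dirCos_le w p).trans_lt hw)
    refine integral_pos_of_pos_of_dotProduct_ne_zero hr hi.re (fun p => ?_) (fun p hp => ?_)
    · rw [extensionDerivIntegrand, Complex.re_ofReal_mul]
      exact mul_nonneg (dotProduct_mul_dirCos_nonneg p) (hq p).le
    · rw [extensionDerivIntegrand, Complex.re_ofReal_mul]
      exact mul_pos (dotProduct_mul_dirCos_pos hp) (hq p)
  · have htm : t ∈ Set.Icc (-1 : ℝ) 1 := abs_le.1 ht.le
    rw [hE t htm, Complex.ofReal_mul]
    change (K : ℂ) * _ = _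
    congr 1
    refine Eq.trans ?_ integral_ofReal
    congr 1
    ext p
    have : |t * dirCos p| < 1 := by
      rw [abs_mul]
      exact (mul_le_of_le_one_right (abs_nonneg _) (abs_dirCos_le_one p)).trans_lt ht
    simp only [hF]
    rw [← Complex.ofReal_mul, cArcsin_ofReal this]
    push_cast
    rfl

/-- The Noshiro–Warschawski criterion on the unit disc. -/
lemma injOn_ball_of_deriv_re_pos {F F' : ℂ → ℂ} (hd : ∀ w, ‖w‖ < 1 → HasDerivAt F (F' w) w)
    (hpos : ∀ w, ‖w‖ < 1 → 0 < (F' w).re) : Set.InjOn F (Metric.ball 0 1) := by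
  intro z hz w hw hzw
  by_contra hne
  set d := w - z with hdd
  have hd0 : d ≠ 0 := sub_ne_zero.2 (Ne.symm hne)
  have hmem : ∀ s ∈ Set.Icc (0 : ℝ) 1, ‖z + s * d‖ < 1 := by
    intro s hs
    have := (convex_ball (0 : ℂ) 1) hz hw (sub_nonneg.2 hs.2) hs.1 (by ring)
    rw [mem_ball_zero_iff] at this
    have e : z + s * d = (1 - s) • z + s • w := by
      rw [Complex.real_smul, Complex.real_smul, hdd]
      push_cast
      ring
    rwa [e]
  -- Along the segment from z to w, the component of F in the direction d has derivative |d|² Re F'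
  -- > 0, so F cannot take equal values at the ends.
  set φ : ℝ → ℝ := fun s => ((starRingEnd ℂ) d * F (z + s * d)).re with hφ
  have hφd : ∀ s ∈ Set.Icc (0 : ℝ) 1,
      HasDerivAt φ (Complex.normSq d * (F' (z + s * d)).re) s := by
    intro s hs
    have h1 : HasDerivAt (fun x : ℂ => z + x * d) d (s : ℂ) := by
      simpa using ((hasDerivAt_id (s : ℂ)).mul_const d).const_add z
    have h2 := (((hd _ (hmem s hs)).comp (s : ℂ) h1).const_mul ((starRingEnd ℂ) d)).real_of_complex
    refine h2.congr_deriv ?_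
    rw [show (starRingEnd ℂ) d * (F' (z + s * d) * d) =
      (Complex.normSq d : ℂ) * F' (z + s * d) by rw [Complex.normSq_eq_conj_mul_self]; ring,
      Complex.re_ofReal_mul]
  have hmono : StrictMonoOn φ (Set.Icc 0 1) := by
    refine strictMonoOn_of_deriv_pos (convex_Icc 0 1)
      (fun s hs => (hφd s hs).continuousAt.continuousWithinAt) fun s hs => ?_
    have hs' := interior_subset hs
    rw [(hφd s hs').deriv]
    exact mul_pos (Complex.normSq_pos.2 hd0) (hpos _ (hmem s hs'))
  have := hmono (Set.left_mem_Icc.2 zero_le_one) (Set.right_mem_Icc.2 zero_le_one) zero_lt_one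
  simp only [hφ, hdd] at this
  simp [hzw] at this

/-- The holomorphic inverse of a function on the unit disc, defined on the open image, together
with the largest disc contained in that image. -/
lemma exists_holomorphic_inverse {F F' : ℂ → ℂ} (hd : ∀ w, ‖w‖ < 1 → HasDerivAt F (F' w) w)
    (hpos : ∀ w, ‖w‖ < 1 → 0 < (F' w).re) (h0 : F 0 = 0) :
    ∃ (h : ℂ → ℂ) (R : ℝ), 0 < R ∧ DifferentiableOn ℂ h (Metric.ball 0 R) ∧
      (∀ z, ‖z‖ < R → ‖h z‖ < 1 ∧ F (h z) = z) ∧ (∀ w, ‖w‖ < 1 → h (F w) = w) ∧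
      ∀ s < 1, ∃ z, ‖z‖ < R ∧ s < ‖h z‖ := by
  have hinj := injOn_ball_of_deriv_re_pos hd hpos
  set U := Metric.ball (0 : ℂ) 1 with hU
  have hUo : IsOpen U := Metric.isOpen_ball
  have hFU : DifferentiableOn ℂ F U := fun w hw =>
    (hd w (by simpa [hU] using hw)).differentiableAt.differentiableWithinAt
  have hstrict : ∀ w ∈ U, HasStrictDerivAt F (F' w) w := by
    intro w hw
    have := (hFU.analyticAt (hUo.mem_nhds hw)).hasStrictDerivAt
    rwa [(hd w (by simpa [hU] using hw)).deriv] at this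
  have hF'0 : ∀ w ∈ U, F' w ≠ 0 := by
    intro w hw h
    have := hpos w (by simpa [hU] using hw)
    simp [h] at this
  set h := Function.invFunOn F U with hh
  have hleft : ∀ w ∈ U, h (F w) = w := fun w hw => hinj.leftInvOn_invFunOn hw
  set Ω := F '' U with hΩ
  have hΩo : IsOpen Ω := by
    rw [isOpen_iff_mem_nhds]
    rintro _ ⟨w, hw, rfl⟩
    rw [← (hstrict w hw).map_nhds_eq (hF'0 w hw)]
    exact Filter.image_mem_map (hUo.mem_nhds hw)
  have hhd : ∀ z ∈ Ω, DifferentiableAt ℂ h z := by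
    rintro _ ⟨w, hw, rfl⟩
    refine ((hstrict w hw).to_local_left_inverse (hF'0 w hw) ?_).hasDerivAt.differentiableAt
    filter_upwards [hUo.mem_nhds hw] with x hx using hleft x hx
  have hright : ∀ z ∈ Ω, h z ∈ U ∧ F (h z) = z := by
    rintro _ ⟨w, hw, rfl⟩
    rw [hleft w hw]
    exact ⟨hw, rfl⟩
  have hU0 : (0 : ℂ) ∈ U := Metric.mem_ball_self one_pos
  have hΩ0 : (0 : ℂ) ∈ Ω := ⟨0, hU0, h0⟩
  -- Otherwise h would be a bounded nonconstant entire function, against Liouville.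
  have hne : Ωᶜ.Nonempty := by
    by_contra hemp
    rw [Set.not_nonempty_iff_eq_empty, Set.compl_empty_iff] at hemp
    have hdiff : Differentiable ℂ h := fun z => hhd z (hemp ▸ Set.mem_univ z)
    have hbdd : Bornology.IsBounded (Set.range h) := by
      refine (Metric.isBounded_ball : Bornology.IsBounded U).subset ?_
      rintro _ ⟨z, rfl⟩
      exact (hright z (hemp ▸ Set.mem_univ z)).1
    have hhalf : (1 / 2 : ℂ) ∈ U := by
      rw [hU, mem_ball_zero_iff]
      norm_num
    have := hdiff.apply_eq_apply_of_bounded hbdd (F (1 / 2)) (F 0)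
    rw [hleft _ hhalf, hleft _ hU0] at this
    norm_num at this
  obtain ⟨z₀, hz₀, hdist⟩ := hΩo.isClosed_compl.exists_infDist_eq_dist hne 0
  set R := Metric.infDist 0 Ωᶜ with hR
  have hball : Metric.ball 0 R ⊆ Ω := Metric.ball_infDist_compl_subset
  have hz₀R : ‖z₀‖ = R := by rw [hdist, dist_zero_left]
  have hR0 : 0 < R := by
    rw [← hz₀R, norm_pos_iff]
    rintro rfl
    exact hz₀ hΩ0
  refine ⟨h, R, hR0, fun z hz => (hhd z (hball hz)).differentiableWithinAt, fun z hz => ?_,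
    fun w hw => hleft w (by simpa [hU] using hw), ?_⟩
  · have := hright z (hball (by simpa using hz))
    exact ⟨by simpa [hU] using this.1, this.2⟩
  · intro s hs
    -- If |h| ≤ s < 1 on the disc, let u n tend radially to the omitted point z₀. A limit point w of
    -- h (u n) has |w| ≤ s, and continuity gives F w = z₀, contradicting z₀ ∉ Ω.
    by_contra! hcon
    set u : ℕ → ℂ := fun n => ((1 - 1 / ((n : ℝ) + 1) : ℝ) : ℂ) * z₀ with hu
    have hun : ∀ n, ‖u n‖ < R := by
      intro n
      have hn : (0 : ℝ) < 1 / ((n : ℝ) + 1) := by positivity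
      have hn1 : 1 / ((n : ℝ) + 1) ≤ 1 := by
        rw [div_le_one (by positivity)]
        linarith [(Nat.cast_nonneg n : (0 : ℝ) ≤ n)]
      rw [hu, norm_mul, Complex.norm_real, hz₀R, Real.norm_of_nonneg (by linarith)]
      nlinarith
    have hulim : Filter.Tendsto u Filter.atTop (nhds z₀) := by
      have h1 : Filter.Tendsto (fun n : ℕ => (1 - 1 / ((n : ℝ) + 1) : ℝ)) Filter.atTop
          (nhds (1 - 0)) := tendsto_const_nhds.sub tendsto_one_div_add_atTop_nhds_zero_nat
      have h2 := ((Complex.continuous_ofReal.tendsto _).comp h1).mul_const z₀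
      simpa [hu, Function.comp_def] using h2
    obtain ⟨w, hw, ψ, hψ, hlim⟩ := (isCompact_closedBall (0 : ℂ) s).tendsto_subseq
      (x := fun n => h (u n)) fun n => by simpa using hcon _ (hun n)
    have hwU : w ∈ U := by
      rw [mem_closedBall_zero_iff] at hw
      rw [hU, mem_ball_zero_iff]
      linarith
    have hF1 : Filter.Tendsto (fun n => F (h (u (ψ n)))) Filter.atTop (nhds (F w)) :=
      ((hstrict w hwU).hasDerivAt.continuousAt.tendsto).comp hlim
    have hF2 : Filter.Tendsto (fun n => F (h (u (ψ n)))) Filter.atTop (nhds z₀) := by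
      refine (hulim.comp hψ.tendsto_atTop).congr fun n => ?_
      exact ((hright _ (hball (by simpa using hun (ψ n)))).2).symm
    exact hz₀ ⟨w, hwU, tendsto_nhds_unique hF1 hF2⟩

/-! ### Taylor coefficients of E_r⁻¹. -/

lemma injOn_E {r : ℕ} (hr : 1 ≤ r) : Set.InjOn (E r) (Set.Icc (-1) 1) := (strictMonoOn_E hr).injOn

lemma EInv_E {r : ℕ} (hr : 1 ≤ r) {s : ℝ} (hs : s ∈ Set.Icc (-1 : ℝ) 1) : EInv r (E r s) = s :=
  (injOn_E hr).leftInvOn_invFunOn hs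

lemma E_zero (r : ℕ) : E r 0 = 0 := by
  have := E_neg r (t := 0) (by norm_num)
  rw [neg_zero] at this
  linarith

/-- Intermediate values on [-1/2, 1/2]. This ensures that `EInv` is a genuine inverse near 0, so
that its germ there determines the Taylor coefficients. -/
lemma eventually_exists_E_eq {r : ℕ} (hr : 1 ≤ r) :
    ∀ᶠ t in nhds (0 : ℝ), ∃ s : ℝ, |s| < 1 ∧ E r s = t := by
  have h1 : (1 / 2 : ℝ) ∈ Set.Icc (-1 : ℝ) 1 := by norm_num
  have h2 : (-(1 / 2) : ℝ) ∈ Set.Icc (-1 : ℝ) 1 := by norm_num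
  have hz : (0 : ℝ) ∈ Set.Icc (-1 : ℝ) 1 := by norm_num
  have p1 : 0 < E r (1 / 2) := by
    have := strictMonoOn_E hr hz h1 (by norm_num)
    rwa [E_zero] at this
  have p2 : E r (-(1 / 2)) < 0 := by
    rw [E_neg r h1]
    linarith
  filter_upwards [Icc_mem_nhds p2 p1] with t ht
  have hc : ContinuousOn (E r) (Set.Icc (-(1 / 2)) (1 / 2)) :=
    (continuousOn_E r).mono (Set.Icc_subset_Icc (by norm_num) (by norm_num))
  obtain ⟨s, hs, hst⟩ := intermediate_value_Icc (by norm_num) hc ht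
  exact ⟨s, by rw [abs_lt]; constructor <;> linarith [hs.1, hs.2], hst⟩

lemma taylorCoeff_even {r : ℕ} (hr : 1 ≤ r) (k : ℕ) : taylorCoeff r (2 * k) = 0 := by
  have hodd : (fun t => EInv r (-t)) =ᶠ[nhds 0] fun t => -EInv r t := by
    filter_upwards [eventually_exists_E_eq hr] with t ht
    obtain ⟨s, hs, rfl⟩ := ht
    have hs' : s ∈ Set.Icc (-1 : ℝ) 1 := abs_le.1 hs.le
    rw [← E_neg r hs', EInv_E hr hs', EInv_E hr ⟨by linarith [hs'.2], by linarith [hs'.1]⟩]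
  have h := hodd.iteratedDeriv_eq (2 * k)
  rw [iteratedDeriv_comp_neg, iteratedDeriv_fun_neg] at h
  simp only [neg_zero, pow_mul, neg_one_sq, one_pow, one_smul] at h
  have : iteratedDeriv (2 * k) (EInv r) 0 = 0 := by linarith
  rw [taylorCoeff, this, zero_div]

/-- The power series of a holomorphic function that is real near `0` on the real line has the
Taylor coefficients of its restriction to the real line. -/
lemma taylorSeries_coeff_eq_of_eventually_eq {h : ℂ → ℂ} {R : ℝ} (hR : 0 < R)
    (hd : DifferentiableOn ℂ h (Metric.ball 0 R)) {e : ℝ → ℝ}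
    (he : ∀ᶠ t : ℝ in nhds 0, h (t : ℂ) = (e t : ℂ)) (n : ℕ) :
    (n.factorial : ℂ)⁻¹ * iteratedDeriv n h 0 = ((iteratedDeriv n e 0 / n.factorial : ℝ) : ℂ) := by
  set c : ℕ → ℂ := fun n => (n.factorial : ℂ)⁻¹ * iteratedDeriv n h 0 with hc
  have hs : ∀ᶠ t : ℝ in nhds 0, HasSum (fun n => c n * (t : ℂ) ^ n) (e t : ℂ) := by
    filter_upwards [he, Metric.ball_mem_nhds (0 : ℝ) hR] with t ht htR
    rw [← ht]
    have := Complex.hasSum_taylorSeries_on_ball hd (z := (t : ℂ)) (by simpa using htR)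
    refine this.congr_fun fun n => ?_
    simp only [hc, sub_zero, smul_eq_mul]
    ring
  have hre : HasFPowerSeriesAt e (FormalMultilinearSeries.ofScalars ℝ fun n => (c n).re) 0 := by
    rw [hasFPowerSeriesAt_iff]
    filter_upwards [hs] with t ht
    have := Complex.hasSum_re ht
    simp only [zero_add, FormalMultilinearSeries.coeff_ofScalars, smul_eq_mul]
    refine this.congr_fun fun n => ?_
    rw [← Complex.ofReal_pow, Complex.re_mul_ofReal, mul_comm]
  -- The sum is real on the real line, so the imaginary parts of the coefficients give a power
  -- series of the zero function and vanish.
  have him : HasFPowerSeriesAt (0 : ℝ → ℝ)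
      (FormalMultilinearSeries.ofScalars ℝ fun n => (c n).im) 0 := by
    rw [hasFPowerSeriesAt_iff]
    filter_upwards [hs] with t ht
    have := Complex.hasSum_im ht
    simp only [FormalMultilinearSeries.coeff_ofScalars, smul_eq_mul]
    refine this.congr_fun fun n => ?_
    rw [← Complex.ofReal_pow, Complex.im_mul_ofReal, mul_comm]
  have h1 : (c n).re = iteratedDeriv n e 0 / n.factorial := by
    have := hre.eq_formalMultilinearSeries hre.analyticAt.hasFPowerSeriesAt
    have := congrArg (fun p => p.coeff n) this
    simpa [FormalMultilinearSeries.coeff_ofScalars] using this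
  have h2 : (c n).im = 0 := by
    have := congrArg (fun p => p.coeff n) him.eq_zero
    simp only [FormalMultilinearSeries.coeff_ofScalars] at this
    exact this
  exact Complex.ext (h1.trans (Complex.ofReal_re _).symm) (h2.trans (Complex.ofReal_im _).symm)

lemma hasSum_odd_iff {f : ℕ → ℂ} (hf : ∀ k, f (2 * k) = 0) {a : ℂ} :
    HasSum (fun k => f (2 * k + 1)) a ↔ HasSum f a := by
  refine Function.Injective.hasSum_iff (g := fun k : ℕ => 2 * k + 1) (fun a b hab => ?_) ?_
  · simpa using hab
  · intro n hn
    rcases Nat.even_or_odd' n with ⟨k, rfl | rfl⟩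
    · exact hf k
    · exact absurd ⟨k, rfl⟩ hn

lemma exists_inverse_series {r : ℕ} (hr : 1 ≤ r) :
    ∃ (F h : ℂ → ℂ) (R : ℝ), 0 < R ∧ DifferentiableOn ℂ F (Metric.ball 0 1) ∧
      (∀ t : ℝ, |t| < 1 → F t = E r t) ∧
      (∀ z, ‖z‖ < R → F (h z) = z ∧
        HasSum (fun k => (taylorCoeff r (2 * k + 1) : ℂ) * z ^ (2 * k + 1)) (h z)) ∧
      ∀ s < 1, ∃ z, ‖z‖ < R ∧ s < ‖h z‖ := by
  obtain ⟨F, F', hd, hpos, hFE⟩ := exists_holomorphic_extension hr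
  have h0 : F 0 = 0 := by
    have := hFE 0 (by simp)
    simpa [E_zero] using this
  obtain ⟨h, R, hR, hhd, hright, hleft, hs⟩ := exists_holomorphic_inverse hd hpos h0
  refine ⟨F, h, R, hR, fun w hw => (hd w (by simpa using hw)).differentiableAt.differentiableWithinAt,
    hFE, fun z hz => ⟨(hright z hz).2, ?_⟩, hs⟩
  have he : ∀ᶠ t : ℝ in nhds 0, h (t : ℂ) = (EInv r t : ℂ) := by
    filter_upwards [eventually_exists_E_eq hr] with t ht
    obtain ⟨s, hs, rfl⟩ := ht
    rw [EInv_E hr (abs_le.1 hs.le), ← hFE s hs, hleft _ (by simpa using hs)]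
  rw [hasSum_odd_iff (f := fun n => (taylorCoeff r n : ℂ) * z ^ n)
    fun k => by simp [taylorCoeff_even hr]]
  have := Complex.hasSum_taylorSeries_on_ball hhd (z := z) (by simpa using hz)
  simp only [sub_zero, smul_eq_mul] at this
  refine this.congr_fun fun n => ?_
  rw [taylorCoeff, ← taylorSeries_coeff_eq_of_eventually_eq hR hhd he n]
  ring

/-! ### The equation for β, and inversion of E_r on [-β, β]. -/

lemma summable_abs_taylorCoeff {r : ℕ} {h : ℂ → ℂ} {R : ℝ}
    (hsum : ∀ z, ‖z‖ < R →
      HasSum (fun k => (taylorCoeff r (2 * k + 1) : ℂ) * z ^ (2 * k + 1)) (h z)) {x : ℝ}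
    (hx0 : 0 ≤ x) (hxR : x < R) :
    Summable fun k : ℕ => |taylorCoeff r (2 * k + 1)| * x ^ (2 * k + 1) := by
  have hx : ‖(x : ℂ)‖ = x := by rw [Complex.norm_real, Real.norm_of_nonneg hx0]
  have := (hsum x (by rwa [hx])).summable.norm
  refine this.congr fun k => ?_
  rw [norm_mul, norm_pow, hx, Complex.norm_real, Real.norm_eq_abs]

/-- The absolute series G dominates |h|, whose supremum on the disc is at least 1. Hence G exceeds
every s < 1 before R and the intermediate value theorem applies; for s = 1 the endpoint R may be
needed. -/
lemma exists_hasSum_abs_taylorCoeff {r : ℕ} (hr : 1 ≤ r) {s : ℝ} (hs0 : 0 < s) (hs1 : s ≤ 1) :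
    ∃ β : ℝ, HasSum (fun k : ℕ => |taylorCoeff r (2 * k + 1)| * β ^ (2 * k + 1)) s := by
  obtain ⟨F, h, R, hR, -, -, hsum, hlarge⟩ := exists_inverse_series hr
  replace hsum := fun z hz => (hsum z hz).2
  set G : ℝ → ℝ := fun x => ∑' k : ℕ, |taylorCoeff r (2 * k + 1)| * x ^ (2 * k + 1) with hG
  have hsm := fun {x : ℝ} => summable_abs_taylorCoeff hsum (x := x)
  have hle : ∀ z, ‖z‖ < R → ‖h z‖ ≤ G ‖z‖ := by
    intro z hz
    refine (hsum z hz).norm_le_of_bounded (hsm (norm_nonneg z) hz).hasSum fun k => ?_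
    rw [norm_mul, norm_pow, Complex.norm_real, Real.norm_eq_abs]
  by_cases hcase : ∃ x, 0 ≤ x ∧ x < R ∧ s ≤ G x
  · obtain ⟨x, hx0, hxR, hsx⟩ := hcase
    have hcont : ContinuousOn G (Set.Icc 0 x) := by
      refine continuousOn_tsum (fun k => by fun_prop) (hsm hx0 hxR) fun k y hy => ?_
      rw [norm_mul, norm_pow, Real.norm_eq_abs, abs_abs, Real.norm_of_nonneg hy.1]
      have := hy.1
      have := hy.2
      gcongr
    have hG0 : G 0 = 0 := by simp [hG]
    obtain ⟨β, hβ, hβs⟩ := intermediate_value_Icc hx0 hcont (show s ∈ Set.Icc (G 0) (G x) from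
      ⟨by rw [hG0]; exact hs0.le, hsx⟩)
    refine ⟨β, ?_⟩
    rw [← hβs]
    exact (hsm hβ.1 (hβ.2.trans_lt hxR)).hasSum
  · push Not at hcase
    have hs : s = 1 := by
      by_contra hne
      obtain ⟨z, hz, hsz⟩ := hlarge s (lt_of_le_of_ne hs1 hne)
      linarith [hle z hz, hcase ‖z‖ (norm_nonneg z) hz]
    subst hs
    have hnn : ∀ k : ℕ, 0 ≤ |taylorCoeff r (2 * k + 1)| * R ^ (2 * k + 1) := fun k => by positivity
    -- Here G < 1 on [0, R). Letting x ↑ R in each finite partial sum gives convergence at R.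
    have hpart : ∀ n, ∑ k ∈ Finset.range n, |taylorCoeff r (2 * k + 1)| * R ^ (2 * k + 1) ≤ 1 := by
      intro n
      have hc : Continuous fun x : ℝ =>
          ∑ k ∈ Finset.range n, |taylorCoeff r (2 * k + 1)| * x ^ (2 * k + 1) := by fun_prop
      refine le_of_tendsto ((hc.tendsto R).mono_left nhdsWithin_le_nhds : Filter.Tendsto _
        (nhdsWithin R (Set.Iio R)) _) ?_
      filter_upwards [Ioo_mem_nhdsLT hR] with x hx
      refine ((hsm hx.1.le hx.2).sum_le_tsum _ fun k _ => ?_).trans (hcase x hx.1.le hx.2).le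
      have := hx.1
      positivity
    have hsR := summable_of_sum_range_le hnn hpart
    refine ⟨R, ?_⟩
    have heq : G R = 1 := by
      refine le_antisymm (Real.tsum_le_of_sum_range_le hnn hpart) ?_
      refine le_of_forall_lt fun s hs => ?_
      obtain ⟨z, hz, hsz⟩ := hlarge s hs
      refine hsz.trans_le ((hle z hz).trans ?_)
      refine (hsm (norm_nonneg z) hz).tsum_le_tsum (fun k => ?_) hsR
      gcongr
    rw [← heq]
    exact hsR.hasSum

lemma pos_of_hasSum_abs_mul_pow_odd {b : ℕ → ℝ} {β s : ℝ} (hs : 0 < s)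
    (h : HasSum (fun k : ℕ => |b k| * β ^ (2 * k + 1)) s) : 0 < β := by
  by_contra hβ
  have hle : s ≤ 0 := by
    refine h.nonpos fun k => mul_nonpos_of_nonneg_of_nonpos (abs_nonneg _) ?_
    exact (Odd.pow_nonpos_iff ⟨k, rfl⟩).2 (not_lt.1 hβ)
  linarith

/-- Every term is nondecreasing in β, and strictly increasing for some nonzero coefficient, which
exists because s > 0. -/
lemma hasSum_abs_mul_pow_odd_unique {b : ℕ → ℝ} {s : ℝ} (hs : 0 < s) {β γ : ℝ}
    (h : HasSum (fun k : ℕ => |b k| * β ^ (2 * k + 1)) s)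
    (h' : HasSum (fun k : ℕ => |b k| * γ ^ (2 * k + 1)) s) : β = γ := by
  wlog hlt : β < γ generalizing β γ
  · rcases lt_trichotomy β γ with hc | hc | hc
    · exact this h h' hc
    · exact hc
    · exact (this h' h hc).symm
  exfalso
  have hβ := pos_of_hasSum_abs_mul_pow_odd hs h
  obtain ⟨k, hk⟩ : ∃ k, b k ≠ 0 := by
    by_contra! hb
    simp only [hb, abs_zero, zero_mul] at h
    exact hs.ne' (h.unique hasSum_zero)
  refine lt_irrefl s (hasSum_lt (fun j => ?_) (i := k) ?_ h h')
  · gcongr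
  · have := abs_pos.2 hk
    gcongr

/-- The Taylor series of `E_r⁻¹` inverts `E_r` on `[-β, β]` as soon as its absolute series at `β`
is at most `1`. -/
lemma E_tsum_taylorCoeff {r : ℕ} (hr : 1 ≤ r) {β s : ℝ} (hs0 : 0 < s) (hs1 : s ≤ 1)
    (hβ : HasSum (fun k : ℕ => |taylorCoeff r (2 * k + 1)| * β ^ (2 * k + 1)) s) {t : ℝ}
    (ht : |t| ≤ β) :
    HasSum (fun k : ℕ => taylorCoeff r (2 * k + 1) * t ^ (2 * k + 1)) (EInv r t) ∧
      E r (EInv r t) = t := by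
  obtain ⟨F, h, R, hR, hF, hFE, hsum, -⟩ := exists_inverse_series hr
  have hβ0 := pos_of_hasSum_abs_mul_pow_odd hs0 hβ
  set T : ℕ → ℂ → ℂ := fun k z => (taylorCoeff r (2 * k + 1) : ℂ) * z ^ (2 * k + 1) with hT
  have hbound : ∀ k z, ‖z‖ ≤ β → ‖T k z‖ ≤ |taylorCoeff r (2 * k + 1)| * β ^ (2 * k + 1) := by
    intro k z hz
    rw [hT, norm_mul, norm_pow, Complex.norm_real, Real.norm_eq_abs]
    gcongr
  have hTs : ∀ z, ‖z‖ ≤ β → Summable fun k => T k z := fun z hz =>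
    hβ.summable.of_norm_bounded fun k => hbound k z hz
  set B : ℂ → ℂ := fun z => ∑' k, T k z with hB
  have hBd : DifferentiableOn ℂ B (Metric.ball 0 β) := by
    refine Complex.differentiableOn_tsum_of_summable_norm hβ.summable (fun k => ?_)
      Metric.isOpen_ball fun k z hz => hbound k z (by simpa using (mem_ball_zero_iff.1 hz).le)
    exact (Differentiable.differentiableOn (by fun_prop))
  -- All exponents are at least 1, so a factor ‖z‖/β comes out. It makes |B| < 1 on the open disc
  -- even when s = 1.
  have hB1 : ∀ z, ‖z‖ ≤ β → ‖B z‖ ≤ ‖z‖ / β * s := by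
    intro z hz
    refine (hTs z hz).hasSum.norm_le_of_bounded (hβ.mul_left (‖z‖ / β)) fun k => ?_
    rw [hT, norm_mul, norm_pow, Complex.norm_real, Real.norm_eq_abs]
    have : ‖z‖ ^ (2 * k + 1) ≤ ‖z‖ / β * β ^ (2 * k + 1) := by
      rw [pow_succ, pow_succ]
      have : ‖z‖ ^ (2 * k) ≤ β ^ (2 * k) := by gcongr
      calc ‖z‖ ^ (2 * k) * ‖z‖ ≤ β ^ (2 * k) * ‖z‖ := by gcongr
        _ = ‖z‖ / β * (β ^ (2 * k) * β) := by field_simp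
    calc |taylorCoeff r (2 * k + 1)| * ‖z‖ ^ (2 * k + 1)
        ≤ |taylorCoeff r (2 * k + 1)| * (‖z‖ / β * β ^ (2 * k + 1)) := by gcongr
      _ = _ := by ring
  have hmaps : ∀ z ∈ Metric.ball (0 : ℂ) β, B z ∈ Metric.ball (0 : ℂ) 1 := by
    intro z hz
    rw [mem_ball_zero_iff] at hz ⊢
    have h1 : ‖z‖ / β < 1 := (div_lt_one hβ0).2 hz
    have h2 : 0 ≤ ‖z‖ / β := by positivity
    nlinarith [hB1 z hz.le]
  -- B agrees with h near 0, and the identity theorem extends F ∘ B = id to the whole disc. No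
  -- comparison of β with R is needed.
  have hFB : Set.EqOn (F ∘ B) id (Metric.ball 0 β) := by
    refine AnalyticOnNhd.eqOn_of_preconnected_of_eventuallyEq
      ((hF.comp hBd hmaps).analyticOnNhd Metric.isOpen_ball)
      (differentiableOn_id.analyticOnNhd Metric.isOpen_ball)
      (convex_ball (0 : ℂ) β).isPreconnected (Metric.mem_ball_self hβ0) ?_
    filter_upwards [Metric.ball_mem_nhds (0 : ℂ) hR] with z hz
    obtain ⟨hz1, hz2⟩ := hsum z (by simpa using hz)
    have hBz : B z = h z := hz2.tsum_eq
    rw [Function.comp_apply, hBz, hz1, id]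
  set Br : ℝ → ℝ := fun t => ∑' k : ℕ, taylorCoeff r (2 * k + 1) * t ^ (2 * k + 1) with hBr
  have hBB : ∀ t : ℝ, B t = Br t := by
    intro t
    simp only [hB, hBr, hT]
    rw [Complex.ofReal_tsum]
    push_cast
    rfl
  have hnt : ∀ {t : ℝ}, t ∈ Set.Icc (-β) β → ‖(t : ℂ)‖ ≤ β := by
    intro t ht
    rw [Complex.norm_real]
    exact abs_le.2 ht
  have hBr1 : Set.MapsTo Br (Set.Icc (-β) β) (Set.Icc (-1) 1) := by
    intro t ht
    have h1 := hB1 t (hnt ht)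
    rw [hBB, Complex.norm_real, Real.norm_eq_abs] at h1
    have h2 : ‖(t : ℂ)‖ / β ≤ 1 := (div_le_one hβ0).2 (hnt ht)
    refine abs_le.1 (h1.trans ?_)
    nlinarith
  have hBrc : ContinuousOn Br (Set.Icc (-β) β) := by
    refine continuousOn_tsum (fun k => by fun_prop) hβ.summable fun k t ht => ?_
    have := hbound k t (hnt ht)
    simpa [hT] using this
  have hEB : Set.EqOn (E r ∘ Br) id (Set.Ioo (-β) β) := by
    intro t ht
    have htb : (t : ℂ) ∈ Metric.ball (0 : ℂ) β := by
      rw [mem_ball_zero_iff, Complex.norm_real]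
      exact abs_lt.2 ht
    have h1 := hFB htb
    have h2 := hmaps _ htb
    rw [hBB, mem_ball_zero_iff, Complex.norm_real] at h2
    rw [Function.comp_apply, hBB, hFE _ h2] at h1
    exact Complex.ofReal_injective h1
  -- At ±β the series may reach ±1, outside the domain of F; continuity of E_r on the closed
  -- interval covers these points.
  have hEBc : Set.EqOn (E r ∘ Br) id (Set.Icc (-β) β) :=
    hEB.of_subset_closure ((continuousOn_E r).comp hBrc hBr1) continuousOn_id
      Set.Ioo_subset_Icc_self (by rw [closure_Ioo (by linarith)])
  have htI : t ∈ Set.Icc (-β) β := abs_le.1 ht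
  have hE : E r (Br t) = t := hEBc htI
  have hinv : EInv r t = Br t := by
    conv_lhs => rw [← hE]
    exact EInv_E hr (hBr1 htI)
  rw [hinv]
  refine ⟨?_, hE⟩
  have hsr : Summable fun k : ℕ => taylorCoeff r (2 * k + 1) * t ^ (2 * k + 1) := by
    refine hβ.summable.of_norm_bounded fun k => ?_
    have := hbound k t (hnt htI)
    simpa [hT] using this
  exact hsr.hasSum

/-! ### Positive semidefinite matrices and the theta number. -/

/-- The 2 × 2 principal minors are nonnegative. This bounds the entries in the compactness argument
for the minimum and dominates the matrix series entrywise. -/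
lemma posSemidef_abs_le {V : Type*} {Z : Matrix V V ℝ} (hZ : Z.PosSemidef) {d : ℝ}
    (hd : ∀ u, Z u u = d) (u v : V) : |Z u v| ≤ d := by
  have h0 : 0 ≤ d := by
    rw [← hd u]
    exact hZ.diag_nonneg
  have hdet := (hZ.submatrix ![u, v]).det_nonneg
  have hsymm : Z v u = Z u v := by simpa using hZ.isHermitian.apply u v
  rw [Matrix.det_fin_two] at hdet
  simp only [Matrix.submatrix_apply, Matrix.cons_val_zero, Matrix.cons_val_one, hd, hsymm] at hdet
  exact abs_le_of_sq_le_sq (by nlinarith) h0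

lemma posSemidef_of_tendsto {V : Type*} [Fintype V] {Z : ℕ → Matrix V V ℝ} {W : Matrix V V ℝ}
    (hZ : ∀ n, (Z n).PosSemidef)
    (h : ∀ u v, Filter.Tendsto (fun n => Z n u v) Filter.atTop (nhds (W u v))) :
    W.PosSemidef := by
  refine Matrix.PosSemidef.of_dotProduct_mulVec_nonneg ?_ fun x => ?_
  · ext u v
    refine tendsto_nhds_unique (h v u) ((h u v).congr fun n => ?_)
    simpa using (hZ n).isHermitian.apply v u
  · have hlim : Filter.Tendsto (fun n => star x ⬝ᵥ (Z n).mulVec x) Filter.atTop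
        (nhds (star x ⬝ᵥ W.mulVec x)) := by
      simp only [dotProduct, Matrix.mulVec]
      exact tendsto_finsetSum _ fun u _ => (tendsto_finsetSum _ fun v _ =>
        (h u v).mul_const _).const_mul _
    exact ge_of_tendsto' hlim fun n => (hZ n).dotProduct_mulVec_nonneg x

lemma posSemidef_const_one {V : Type*} [Fintype V] :
    (Matrix.of fun _ _ : V => (1 : ℝ)).PosSemidef := by
  have := Matrix.posSemidef_vecMulVec_self_star (fun _ : V => (1 : ℝ))
  convert this using 1
  ext u v
  simp [Matrix.vecMulVec_apply]

/-- An edge entry has modulus 1, at most the diagonal λ - 1. This places the right side of the β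
equation in (0, 1]. -/
lemma two_le_of_thetaFeasible {V : Type*} {G : SimpleGraph V} (hG : ∃ u v, G.Adj u v)
    {lam : ℝ} (h : ThetaFeasible G lam) : 2 ≤ lam := by
  obtain ⟨u, v, huv⟩ := hG
  obtain ⟨Z, hZ, hd, he⟩ := h
  have := posSemidef_abs_le hZ hd u v
  rw [he u v huv, abs_neg, abs_one] at this
  linarith

lemma thetaFeasible_card {V : Type*} [Fintype V] (G : SimpleGraph V) :
    ThetaFeasible G (Fintype.card V) := by
  classical
  -- The witness |V| I - J, with J the all-ones matrix, is positive semidefinite by Cauchy–Schwarz.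
  refine ⟨(Fintype.card V : ℝ) • (1 : Matrix V V ℝ) - Matrix.of fun _ _ => 1,
    Matrix.PosSemidef.of_dotProduct_mulVec_nonneg ?_ fun x => ?_, fun u => by simp, ?_⟩
  · ext u v
    simp [Matrix.one_apply, eq_comm]
  · have h1 : (Matrix.of fun _ _ : V => (1 : ℝ)).mulVec x = fun _ => ∑ v, x v := by
      ext u
      simp [Matrix.mulVec, dotProduct]
    have h2 := sq_sum_le_card_mul_sum_sq (s := Finset.univ) (f := x)
    rw [Matrix.sub_mulVec, Matrix.smul_mulVec, Matrix.one_mulVec, h1, dotProduct_sub,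
      dotProduct_smul]
    simp only [dotProduct, star_trivial, ← Finset.sum_mul, smul_eq_mul]
    simp only [Finset.card_univ, pow_two] at h2
    linarith
  · intro u v huv
    simp [huv.ne]

/-- The minimum in the definition of the theta number is attained. -/
lemma thetaFeasible_thetaCompl {V : Type*} [Fintype V] {G : SimpleGraph V}
    (hG : ∃ u v, G.Adj u v) : ThetaFeasible G (thetaCompl G) := by
  have hne : {lam : ℝ | ThetaFeasible G lam}.Nonempty := ⟨_, thetaFeasible_card G⟩
  have hbdd : BddBelow {lam : ℝ | ThetaFeasible G lam} :=
    ⟨2, fun _ h => two_le_of_thetaFeasible hG h⟩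
  obtain ⟨lam, hanti, hlim, hmem⟩ := exists_seq_tendsto_sInf hne hbdd
  choose Z hZ hd he using hmem
  have hcpt : IsCompact (Set.univ.pi fun _ : V => Set.univ.pi fun _ : V =>
      Set.Icc (-(lam 0 - 1)) (lam 0 - 1)) :=
    isCompact_univ_pi fun _ => isCompact_univ_pi fun _ => isCompact_Icc
  obtain ⟨W, -, φ, hφ, hW⟩ := hcpt.tendsto_subseq (x := fun n u v => Z n u v) fun n u _ v _ => by
    have h1 := posSemidef_abs_le (hZ n) (hd n) u v
    have h2 := hanti (Nat.zero_le n)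
    exact abs_le.1 (by linarith)
  have hWuv : ∀ u v, Filter.Tendsto (fun n => Z (φ n) u v) Filter.atTop (nhds (W u v)) :=
    fun u v => tendsto_pi_nhds.1 (tendsto_pi_nhds.1 hW u) v
  refine ⟨Matrix.of W, posSemidef_of_tendsto (fun n => hZ (φ n)) hWuv, fun u => ?_,
    fun u v huv => ?_⟩
  · refine tendsto_nhds_unique (hWuv u u) ?_
    simp only [hd]
    exact (hlim.comp hφ.tendsto_atTop).sub_const 1
  · refine tendsto_nhds_unique (hWuv u v) ?_
    simp only [he _ u v huv]
    exact tendsto_const_nhds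

lemma two_le_thetaCompl {V : Type*} [Fintype V] {G : SimpleGraph V} (hG : ∃ u v, G.Adj u v) :
    2 ≤ thetaCompl G :=
  two_le_of_thetaFeasible hG (thetaFeasible_thetaCompl hG)

/-! ### Krivine's construction of the vectors g. -/

-- The columns of the symmetric square root of M have Gram matrix M.
open scoped MatrixOrder in
lemma exists_unitSphere_of_posSemidef {V : Type*} [Fintype V] {M : Matrix V V ℝ}
    (hM : M.PosSemidef) (hd : ∀ u, M u u = 1) :
    ∃ g : V → unitSphere (Fintype.card V), ∀ u v, inner ℝ (g u).1 (g v).1 = M u v := by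
  classical
  set B := CFC.sqrt M with hB
  have hBB : B * B = M := CFC.sqrt_mul_sqrt_self M hM.nonneg
  have hBH : B.IsHermitian := (Matrix.nonneg_iff_posSemidef.1 (CFC.sqrt_nonneg M)).isHermitian
  set e := Fintype.equivFin V
  set g : V → EuclideanSpace ℝ (Fin (Fintype.card V)) := fun u =>
    WithLp.toLp 2 fun i => B (e.symm i) u with hg
  have hin : ∀ u v, inner ℝ (g u) (g v) = M u v := by
    intro u v
    rw [PiLp.inner_apply, ← hBB, Matrix.mul_apply, ← e.symm.sum_comp]
    refine Finset.sum_congr rfl fun i _ => ?_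
    have : B u (e.symm i) = B (e.symm i) u := by simpa using hBH.apply (e.symm i) u
    simp [hg, this, mul_comm]
  refine ⟨fun u => ⟨g u, ?_⟩, hin⟩
  rw [mem_sphere_zero_iff_norm, ← sq_eq_sq₀ (norm_nonneg _) zero_le_one,
    ← real_inner_self_eq_norm_sq, hin, hd, one_pow]

/-- Schur product theorem applied to powers of the Gram matrix. -/
lemma posSemidef_inner_pow {V : Type*} [Fintype V] {n : ℕ} (f : V → EuclideanSpace ℝ (Fin n))
    (k : ℕ) : (Matrix.of fun u v => inner ℝ (f u) (f v) ^ k).PosSemidef := by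
  induction k with
  | zero => simpa using posSemidef_const_one
  | succ k ih =>
    have e : (Matrix.of fun u v => inner ℝ (f u) (f v) ^ (k + 1)) =
        (Matrix.of fun u v => inner ℝ (f u) (f v) ^ k).hadamard (Matrix.gram ℝ f) := by
      ext u v
      simp [Matrix.gram_apply, pow_succ]
    rw [e]
    exact ih.hadamard (Matrix.posSemidef_gram ℝ f)

/-- The matrix form of Krivine's argument: a power series with coefficients of arbitrary signs is
applied to the inner products of adjacent vertices. -/
lemma exists_unitSphere_inner_eq_series {V : Type*} [Fintype V] {G : SimpleGraph V}
    (hG : ∃ u v, G.Adj u v) {b : ℕ → ℝ} {β : ℝ}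
    (hβ : HasSum (fun k : ℕ => |b k| * β ^ (2 * k + 1)) (1 / (thetaCompl G - 1)))
    (f : V → unitSphere (Fintype.card V)) :
    ∃ g : V → unitSphere (Fintype.card V), ∀ u v, G.Adj u v →
      HasSum (fun k : ℕ => b k * (β * inner ℝ (f u).1 (f v).1) ^ (2 * k + 1))
        (inner ℝ (g u).1 (g v).1) := by
  classical
  have htwo := two_le_thetaCompl hG
  obtain ⟨Z, hZ, hZd, hZe⟩ := thetaFeasible_thetaCompl hG
  set θ := thetaCompl G
  have hβ0 : 0 < β := pos_of_hasSum_abs_mul_pow_odd (one_div_pos.2 (by linarith)) hβ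
  -- The positive counterpart of Z: same diagonal θ - 1, but +1 on edges. Positivity uses θ ≥ 2.
  set P : Matrix V V ℝ := (Matrix.of fun _ _ => 1) + (θ - 2) • (1 : Matrix V V ℝ) with hP
  have hPpos : P.PosSemidef :=
    posSemidef_const_one.add (Matrix.PosSemidef.one.smul (by linarith))
  set W : ℕ → Matrix V V ℝ := fun k => if 0 ≤ b k then P else Z with hW
  have hWpos : ∀ k, (W k).PosSemidef := by
    intro k
    simp only [hW]
    split_ifs
    exacts [hPpos, hZ]
  have hWd : ∀ k u, W k u u = θ - 1 := by
    intro k u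
    simp only [hW]
    split_ifs
    · simp [hP]
      ring
    · exact hZd u
  have hWe : ∀ k u v, G.Adj u v → |b k| * W k u v = b k := by
    intro k u v huv
    simp only [hW]
    split_ifs with hk
    · simp [hP, huv.ne, abs_of_nonneg hk]
    · rw [hZe u v huv, abs_of_neg (not_le.1 hk)]
      ring
  set H : ℕ → Matrix V V ℝ := fun k =>
    Matrix.of fun u v => inner ℝ (f u).1 (f v).1 ^ (2 * k + 1) with hH
  set T : ℕ → Matrix V V ℝ := fun k =>
    (|b k| * β ^ (2 * k + 1)) • (H k).hadamard (W k) with hT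
  have hTpos : ∀ k, (T k).PosSemidef := fun k =>
    ((posSemidef_inner_pow (fun u => (f u).1) (2 * k + 1)).hadamard (hWpos k)).smul (by positivity)
  have hTapp : ∀ k u v, T k u v =
      |b k| * β ^ (2 * k + 1) * (inner ℝ (f u).1 (f v).1 ^ (2 * k + 1) * W k u v) := by
    intro k u v
    simp [hT, hH]
  have hnorm : ∀ u, ‖(f u).1‖ = 1 := fun u => mem_sphere_zero_iff_norm.1 (f u).2
  -- The diagonal factor θ - 1 cancels the right side 1 / (θ - 1) of the equation for β; this is why
  -- that value is prescribed.
  have hTd : ∀ u, HasSum (fun k => T k u u) 1 := by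
    intro u
    have h1 := hβ.mul_right (θ - 1)
    rw [one_div_mul_cancel (by linarith)] at h1
    refine h1.congr_fun fun k => ?_
    rw [hTapp, real_inner_self_eq_norm_sq, hnorm, hWd]
    simp
  have hTs : ∀ u v, Summable fun k => T k u v := by
    intro u v
    refine (hβ.summable.mul_right (θ - 1)).of_norm_bounded fun k => ?_
    have h1 := posSemidef_abs_le (hWpos k) (hWd k) u v
    have h2 : |inner ℝ (f u).1 (f v).1| ≤ 1 :=
      abs_le.2 (mem_Icc_inner_of_norm_eq_one (hnorm u) (hnorm v))
    rw [hTapp, Real.norm_eq_abs, abs_mul, abs_mul, abs_mul, abs_abs, abs_pow, abs_pow,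
      abs_of_pos hβ0]
    refine mul_le_mul_of_nonneg_left ?_ (by positivity)
    have h3 : |inner ℝ (f u).1 (f v).1| ^ (2 * k + 1) ≤ 1 := pow_le_one₀ (abs_nonneg _) h2
    exact (mul_le_of_le_one_left (abs_nonneg _) h3).trans h1
  set M : Matrix V V ℝ := Matrix.of fun u v => ∑' k, T k u v with hM
  have hMpos : M.PosSemidef := by
    refine posSemidef_of_tendsto (Z := fun n => ∑ k ∈ Finset.range n, T k)
      (fun n => Matrix.posSemidef_sum _ fun k _ => hTpos k) fun u v => ?_
    simp only [Matrix.sum_apply]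
    exact (hTs u v).hasSum.tendsto_sum_nat
  obtain ⟨g, hg⟩ := exists_unitSphere_of_posSemidef hMpos fun u => (hTd u).tsum_eq
  refine ⟨g, fun u v huv => ?_⟩
  rw [hg]
  refine (hTs u v).hasSum.congr_fun fun k => ?_
  rw [hTapp, mul_pow]
  conv_lhs => rw [← hWe k u v huv]
  ring

end RankGrothendieck

theorem lemma4p1 {V : Type*} [Fintype V] (G : SimpleGraph V) (hG : ∃ u v, G.Adj u v)
    (r : ℕ) (hr : 1 ≤ r) :
    (∃! β : ℝ, RankGrothendieck.SolvesBetaEquation r G β) ∧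
    ∀ β : ℝ, RankGrothendieck.SolvesBetaEquation r G β →
      (∀ t : ℝ, |t| ≤ β → HasSum
        (fun k : ℕ => RankGrothendieck.taylorCoeff r (2 * k + 1) * t ^ (2 * k + 1))
        (RankGrothendieck.EInv r t)) ∧
      ∀ f : V → RankGrothendieck.unitSphere (Fintype.card V),
        ∃ g : V → RankGrothendieck.unitSphere (Fintype.card V),
          ∀ u v : V, G.Adj u v →
            RankGrothendieck.E r (inner ℝ (g u).1 (g v).1) = β * inner ℝ (f u).1 (f v).1 := by
  have htwo := RankGrothendieck.two_le_thetaCompl hG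
  have hpos : 0 < 1 / (RankGrothendieck.thetaCompl G - 1) := one_div_pos.2 (by linarith)
  have hle : 1 / (RankGrothendieck.thetaCompl G - 1) ≤ 1 := by
    rw [div_le_one (by linarith)]
    linarith
  refine ⟨?_, fun β hβ =>
    ⟨fun t ht => (RankGrothendieck.E_tsum_taylorCoeff hr hpos hle hβ ht).1, fun f => ?_⟩⟩
  · obtain ⟨β, hβ⟩ := RankGrothendieck.exists_hasSum_abs_taylorCoeff hr hpos hle
    exact ⟨β, hβ, fun γ hγ => RankGrothendieck.hasSum_abs_mul_pow_odd_unique hpos hγ hβ⟩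
  · obtain ⟨g, hg⟩ := RankGrothendieck.exists_unitSphere_inner_eq_series hG hβ f
    refine ⟨g, fun u v huv => ?_⟩
    have hβ0 := RankGrothendieck.pos_of_hasSum_abs_mul_pow_odd hpos hβ
    have ht : |β * inner ℝ (f u).1 (f v).1| ≤ β := by
      rw [abs_mul, abs_of_pos hβ0]
      refine mul_le_of_le_one_right hβ0.le (abs_le.2 ?_)
      exact RankGrothendieck.mem_Icc_inner_of_norm_eq_one (mem_sphere_zero_iff_norm.1 (f u).2)
        (mem_sphere_zero_iff_norm.1 (f v).2)
    -- On an edge, g(u)·g(v) is the Taylor series at β f(u)·f(v), hence the value of E_r⁻¹ there.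
    have h := RankGrothendieck.E_tsum_taylorCoeff hr hpos hle hβ ht
    rw [(hg u v huv).unique h.1, h.2]
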